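/- For each $N$ let $y_{i,t}\in\{0,1\}$ and $p_{i,t}$ ($i=1,\dots,N$, $t=0,1,2,\dots$) be random variables on some probability space (which may depend on $N$) that, for all sufficiently large $N$, follow the interactive GAB(1,1) model: the initial probabilities $p_{i,0}\in[0,1]$ may be random; conditionally on $p_{1,0},\dots,p_{N,0}$ and all $y_{j,s}$ with $s<t$, the variables $y_{1,t},\dots,y_{N,t}$ are independent and $y_{i,t}$ is Bernoulli with success probability $p_{i,t}$ (for every $t\ge0$); and for $t\ge1$ $$p_{i,t}=\omega_i+\alpha_i\,y_{i,t-1}+\gamma_i\,\frac1N\sum_{j=1}^N y_{j,t-1}+\beta_i\,p_{i,t-1},\qquad \omega_i,\alpha_i,\gamma_i,\beta_i\ge0,\quad \omega_i+\alpha_i+\gamma_i+\beta_i\le1 .$$ Suppose that $\omega_i=c_i/N$, $\alpha_i=a_i/N^{\kappa}$ and $\beta_i=\beta$ for all $i$, where $\kappa>0$ and $0\le c_i,a_i\le C<\infty$ (the numbers $c_i,a_i,\gamma_i,\beta,\kappa,C$ do not depend on $N$), and that the limits $$\bar c=\lim_{N\to\infty}\frac1N\sum_{i=1}^N c_i,\qquad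 \bar\gamma=\lim_{N\to\infty}\frac1N\sum_{i=1}^N\gamma_i$$ exist. Suppose further that, for some integrable real random variable $\lambda_0$, as $N\to\infty$, $$\sum_{i=1}^N p_{i,0}\xrightarrow{d}\lambda_0,\qquad \sum_{i=1}^N\mathbb E\,p_{i,0}\to\mathbb E\lambda_0,\qquad \max_{1\le i\le N}p_{i,0}\xrightarrow{p}0 .$$ Let $X_t(N)=\sum_{i=1}^N y_{i,t}$. Then there are, on some probability space, a process $(X_t)_{t\ge0}$ with values in $\{0,1,2,\dots\}$ and a process $(\lambda_t)_{t\ge0}$ with values in $[0,\infty)$, whose initial value has the law of the given $\lambda_0$ (and is again denoted $\lambda_0$), such that: 1. as $N\to\infty$, $(X_t(N))_{t\ge0}$ converges in finite-dimensional distributions to $(X_t)_{t\ge0}$; 2. for each $t\ge0$, conditionally on the $\sigma$-field $\mathcal I^X_{t-1}$ generated by $X_{t-1},\dots,X_0,\lambda_0$ (by $\lambda_0$ alone when $t=0$), $X_t$ has the Poisson distribution $\mathrm{Pois}(\lambda_t)$; 3. $\lambda_t$ is the limit of $\sum_{i=1}^N p_{i,t}$, in the sense that $\bigl(X_t(N),\sum_{i=1}^N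 p_{i,t}\bigr)_{t\ge0}$ converges in finite-dimensional distributions to $(X_t,\lambda_t)_{t\ge0}$; 4. for each $t\ge1$, $\lambda_t=\bar c+\bar\gamma X_{t-1}+\beta\lambda_{t-1}$. -/

import Mathlib

open MeasureTheory ProbabilityTheory Filter Topology
open scoped NNReal

noncomputable section

/-- The information available in a binary panel before date `t`: the `σ`-field generated by the
(possibly random) initial probabilities `p_{j,0}` and by the outcomes `y_{j,s}`, `s < t`. -/
@[reducible]
def panelPast {Ω : Type*} {N : ℕ} (y : Fin N → ℕ → Ω → Bool) (p : Fin N → ℕ → Ω → ℝ) (t : ℕ) :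
    MeasurableSpace Ω :=
  (⨆ j, MeasurableSpace.comap (p j 0) inferInstance) ⊔
    ⨆ s ∈ Finset.range t, ⨆ j, MeasurableSpace.comap (y j s) inferInstance

/-- The number of successes `∑ j, y_{j,t}` at date `t`. -/
def aggregateCount {Ω : Type*} {N : ℕ} (y : Fin N → ℕ → Ω → Bool) (t : ℕ) (w : Ω) : ℕ :=
  ∑ j, (y j t w).toNat

/-- The interactive GAB(1,1) model for an `N`-dimensional binary panel at dates `t = 0, 1, …`, with
coefficients `ω_i`, `α_i`, `γ_i`, `β_i`, outcomes `y_{i,t}` (`true` is `1`, `false` is `0`) and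
success probabilities `p_{i,t}`, which are random variables on a probability space `(Ω, P)`. -/
structure InteractiveGAB {Ω : Type*} [MeasurableSpace Ω] (P : Measure Ω) {N : ℕ}
    (ω α γ β : Fin N → ℝ) (y : Fin N → ℕ → Ω → Bool) (p : Fin N → ℕ → Ω → ℝ) : Prop where
  measurable_y : ∀ i t, Measurable (y i t)
  measurable_p : ∀ i t, Measurable (p i t)
  omega_nonneg : ∀ i, 0 ≤ ω i
  alpha_nonneg : ∀ i, 0 ≤ α i
  gamma_nonneg : ∀ i, 0 ≤ γ i
  beta_nonneg : ∀ i, 0 ≤ β i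
  sum_le_one : ∀ i, ω i + α i + γ i + β i ≤ 1
  /-- The initial probabilities may be random. -/
  initial_mem : ∀ i w, p i 0 w ∈ Set.Icc (0 : ℝ) 1
  recursion : ∀ i t w, p i (t + 1) w =
    ω i + α i * ((y i t w).toNat : ℝ) + γ i * (1 / (N : ℝ) * ∑ j, ((y j t w).toNat : ℝ))
      + β i * p i t w
  /-- Given the past, the outcomes at date `t` are independent, and `y_{i,t}` is Bernoulli with
  success probability `p_{i,t}`: the conditional probability of each outcome vector `b` is the
  product of the Bernoulli probabilities. -/
  condLaw : ∀ (t : ℕ) (b : Fin N → Bool),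
    P⟦{w | ∀ i, y i t w = b i} | panelPast y p t⟧ =ᵐ[P]
      fun w => ∏ i, if b i = true then p i t w else 1 - p i t w

/-- The `σ`-field generated by `X_0, …, X_{t-1}` and `λ_0` (only by `λ_0` when `t = 0`). -/
@[reducible]
def countPast {Ω : Type*} (X : ℕ → Ω → ℕ) (lam : ℕ → Ω → ℝ≥0) (t : ℕ) : MeasurableSpace Ω :=
  MeasurableSpace.comap (lam 0) inferInstance ⊔
    ⨆ s ∈ Finset.range t, MeasurableSpace.comap (X s) inferInstance

/-- A Poisson autoregression (INGARCH(1,1) process) with counts `X_t` and intensities `λ_t`: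
conditionally on `X_0, …, X_{t-1}, λ_0` the count `X_t` has the Poisson law with mean `λ_t`, and
`λ_{t+1} = c + g X_t + b λ_t`. -/
structure PoissonAutoregression {Ω : Type*} [MeasurableSpace Ω] (Q : Measure Ω) (c g b : ℝ)
    (X : ℕ → Ω → ℕ) (lam : ℕ → Ω → ℝ≥0) : Prop where
  measurable_X : ∀ t, Measurable (X t)
  measurable_lam : ∀ t, Measurable (lam t)
  condLaw : ∀ (t : ℕ) (A : Set ℕ),
    Q⟦X t ⁻¹' A | countPast X lam t⟧ =ᵐ[Q] fun w => (poissonMeasure (lam t w)).real A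
  recursion : ∀ t w, (lam (t + 1) w : ℝ) = c + g * (X t w : ℝ) + b * (lam t w : ℝ)

/-- Convergence in finite-dimensional distributions, as `N → ∞`, of processes `Z N` indexed by
`t = 0, 1, …`, each on its own probability space, to a process `Z'`. -/
def TendstoFDD {E : Type*} [TopologicalSpace E] [SecondCountableTopology E] [MeasurableSpace E]
    [BorelSpace E] {Ω : ℕ → Type*} [∀ N, MeasurableSpace (Ω N)] {Ω' : Type*} [MeasurableSpace Ω']
    (P : (N : ℕ) → Measure (Ω N)) [∀ N, IsProbabilityMeasure (P N)]
    (Q : Measure Ω') [IsProbabilityMeasure Q]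
    (Z : (N : ℕ) → ℕ → Ω N → E) (Z' : ℕ → Ω' → E) : Prop :=
  ∀ I : Finset ℕ, TendstoInDistribution (fun N w (t : I) => Z N t w) atTop
    (fun w (t : I) => Z' t w) P Q

end

/-! Given the past, `X_t(N)` is a sum of independent Bernoulli variables, so its conditional
characteristic function is `∏ (1 + p_i z)` with `z = exp(iv) - 1`. This differs from the Poisson
value `exp(z ∑ p_i)` by at most `8 (max p_i) ∑ p_i` (`norm_prod_bernoulli_sub_exp_le`). A Poisson
limit thus needs only two facts at each date: the probabilities are uniformly small, and their sum
is asymptotically a function of the past.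

Both facts propagate. Summing the recursion over `i`, the `ω` terms tend to `cbar`, the `α` terms
are at most `C N^(-κ) X_t(N)`, the `γ` terms are the mean of the `γ_i` times `X_t(N)`, and the
common `β` factors out. Hence `∑ p_{i,t+1}` is close to `cbar + γbar X_t(N) + β ∑ p_{i,t}`, while
the largest probability grows by at most `C/N + C/N^κ + X_t(N)/N`. Everything added vanishes in
probability as soon as `X_t(N)` is bounded in probability, which its convergence in law provides.

The induction on `t` (`tendstoInDistribution_truncatedPath`) therefore carries three claims: the
initial sum and the earlier counts converge jointly in law, the probabilities are dominated by a
variable tending to zero in probability, and `∑ p_{i,t}` minus the intensity computed from the past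
tends to zero in probability. A new count is adjoined by testing with `f(past) exp(iv X_t)`; Fourier
inversion in the integer coordinate turns this into joint convergence
(`tendstoInDistribution_prodMk_nat`). The limit process is built from independent uniform variables
(`exists_poissonAutoregression`), and Slutsky's theorem finally replaces the computed intensities by
the actual sums. -/

/-! ### Stochastic order calculus on varying probability spaces -/

section ConvergenceInProbability

/-- Convergence in probability to zero of real functions on varying probability spaces. -/
def TendstoZeroInProb {Ω : ℕ → Type*} [∀ N, MeasurableSpace (Ω N)]
    (P : (N : ℕ) → Measure (Ω N)) (g : (N : ℕ) → Ω N → ℝ) : Prop :=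
  ∀ ε : ℝ, 0 < ε → Tendsto (fun N => P N {w | ε ≤ |g N w|}) atTop (𝓝 0)

/-- Boundedness in probability of real functions on varying probability spaces. -/
def BoundedInProb {Ω : ℕ → Type*} [∀ N, MeasurableSpace (Ω N)]
    (P : (N : ℕ) → Measure (Ω N)) (g : (N : ℕ) → Ω N → ℝ) : Prop :=
  ∀ ε : ENNReal, 0 < ε → ∃ K : ℝ, ∀ᶠ N in atTop, P N {w | K ≤ |g N w|} ≤ ε

variable {Ω : ℕ → Type*} [∀ N, MeasurableSpace (Ω N)] {P : (N : ℕ) → Measure (Ω N)}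
  {g h : (N : ℕ) → Ω N → ℝ}

lemma TendstoZeroInProb.mono (hh : TendstoZeroInProb P h)
    (hle : ∀ᶠ N in atTop, ∀ w, |g N w| ≤ |h N w|) : TendstoZeroInProb P g := by
  intro ε hε
  refine tendsto_of_tendsto_of_tendsto_of_le_of_le' tendsto_const_nhds (hh ε hε)
    (Eventually.of_forall fun N => zero_le) ?_
  filter_upwards [hle] with N hN
  exact measure_mono fun w (hw : ε ≤ _) => hw.trans (hN w)

lemma TendstoZeroInProb.add (hg : TendstoZeroInProb P g) (hh : TendstoZeroInProb P h) :
    TendstoZeroInProb P (fun N w => g N w + h N w) := by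
  intro ε hε
  have key := (hg (ε / 2) (half_pos hε)).add (hh (ε / 2) (half_pos hε))
  rw [add_zero] at key
  refine tendsto_of_tendsto_of_tendsto_of_le_of_le tendsto_const_nhds key
    (fun N => zero_le) fun N => ?_
  refine (measure_mono fun w (hw : ε ≤ _) => ?_).trans (measure_union_le _ _)
  by_contra hcon
  simp only [Set.mem_union, Set.mem_ofPred_eq, not_or, not_le] at hcon
  have := abs_add_le (g N w) (h N w)
  linarith [hcon.1, hcon.2]

lemma TendstoZeroInProb.abs (hg : TendstoZeroInProb P g) :
    TendstoZeroInProb P (fun N w => |g N w|) :=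
  hg.mono (Eventually.of_forall fun _ _ => (abs_abs _).le)

lemma tendstoZeroInProb_const [∀ N, IsProbabilityMeasure (P N)] {e : ℕ → ℝ}
    (he : Tendsto e atTop (𝓝 0)) : TendstoZeroInProb P (fun N _ => e N) := by
  intro ε hε
  refine tendsto_const_nhds.congr' ?_
  filter_upwards [(tendsto_order.1 he.abs).2 ε (by simpa using hε)] with N hN
  simp [not_le.2 hN]

lemma boundedInProb_const (K : ℝ) : BoundedInProb P (fun _ _ => K) := fun ε _ =>
  ⟨|K| + 1, Eventually.of_forall fun N => by simp [not_le.2 (zero_lt_one (α := ℝ))]⟩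

lemma BoundedInProb.mono (hh : BoundedInProb P h)
    (hle : ∀ᶠ N in atTop, ∀ w, |g N w| ≤ |h N w|) : BoundedInProb P g := by
  intro ε hε
  obtain ⟨K, hK⟩ := hh ε hε
  refine ⟨K, ?_⟩
  filter_upwards [hK, hle] with N hN hN'
  exact (measure_mono fun w (hw : K ≤ _) => hw.trans (hN' w)).trans hN

lemma TendstoZeroInProb.boundedInProb (hg : TendstoZeroInProb P g) : BoundedInProb P g := by
  intro ε hε
  refine ⟨1, ?_⟩
  filter_upwards [(tendsto_order.1 (hg 1 one_pos)).2 ε hε] with N hN using hN.le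

lemma BoundedInProb.add (hg : BoundedInProb P g) (hh : BoundedInProb P h) :
    BoundedInProb P (fun N w => g N w + h N w) := by
  intro ε hε
  obtain ⟨K, hK⟩ := hg (ε / 2) (ENNReal.half_pos hε.ne')
  obtain ⟨K', hK'⟩ := hh (ε / 2) (ENNReal.half_pos hε.ne')
  refine ⟨K + K', ?_⟩
  filter_upwards [hK, hK'] with N hN hN'
  calc _ ≤ P N ({w | K ≤ |g N w|} ∪ {w | K' ≤ |h N w|}) := by
        refine measure_mono fun w (hw : K + K' ≤ _) => ?_
        by_contra hcon
        simp only [Set.mem_union, Set.mem_ofPred_eq, not_or, not_le] at hcon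
        have := abs_add_le (g N w) (h N w)
        linarith [hcon.1, hcon.2]
    _ ≤ _ := measure_union_le _ _
    _ ≤ ε / 2 + ε / 2 := add_le_add hN hN'
    _ = ε := ENNReal.add_halves ε

lemma TendstoZeroInProb.mul_bounded (hg : TendstoZeroInProb P g) (hh : BoundedInProb P h) :
    TendstoZeroInProb P (fun N w => g N w * h N w) := by
  intro ε hε
  rw [ENNReal.tendsto_nhds_zero]
  intro δ hδ
  obtain ⟨K, hK⟩ := hh (δ / 2) (ENNReal.half_pos hδ.ne')
  have hK1 : 0 < |K| + 1 := by positivity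
  filter_upwards [hK, (tendsto_order.1 (hg (ε / (|K| + 1)) (by positivity))).2 (δ / 2)
    (ENNReal.half_pos hδ.ne')] with N hN hN'
  calc _ ≤ P N ({w | ε / (|K| + 1) ≤ |g N w|} ∪ {w | K ≤ |h N w|}) := by
        refine measure_mono fun w (hw : ε ≤ _) => ?_
        by_contra hcon
        simp only [Set.mem_union, Set.mem_ofPred_eq, not_or, not_le] at hcon
        obtain ⟨h1, h2⟩ := hcon
        rw [lt_div_iff₀ hK1] at h1
        rw [abs_mul] at hw
        have : |g N w| * |h N w| ≤ |g N w| * (|K| + 1) := by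
          gcongr
          linarith [le_abs_self K]
        linarith
    _ ≤ _ := measure_union_le _ _
    _ ≤ δ / 2 + δ / 2 := add_le_add hN'.le hN
    _ = δ := ENNReal.add_halves δ

/-- Uniformly bounded functions that tend to zero in probability have vanishing integrals. -/
lemma tendsto_integral_zero_of_tendstoZeroInProb [∀ N, IsProbabilityMeasure (P N)]
    {E : Type*} [NormedAddCommGroup E] [NormedSpace ℝ E] {G : (N : ℕ) → Ω N → E} {B : ℝ}
    (hG : ∀ᶠ N in atTop, AEStronglyMeasurable (G N) (P N))
    (hB : ∀ᶠ N in atTop, ∀ w, ‖G N w‖ ≤ B)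
    (h0 : TendstoZeroInProb P (fun N w => ‖G N w‖)) :
    Tendsto (fun N => ∫ w, G N w ∂(P N)) atTop (𝓝 0) := by
  rw [Metric.tendsto_nhds]
  intro ε hε
  have hB1 : 0 < |B| + 1 := by positivity
  have h1 := h0 (ε / 2) (half_pos hε)
  have h2 := (tendsto_order.1 h1).2 (ENNReal.ofReal (ε / 2 / (|B| + 1)))
    (ENNReal.ofReal_pos.2 (by positivity))
  filter_upwards [hG, hB, h2] with N hGN hBN hN
  simp only [abs_norm] at hN
  rw [dist_zero_right]
  have hmeas : NullMeasurableSet {w | ε / 2 ≤ ‖G N w‖} (P N) :=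
    nullMeasurableSet_le aemeasurable_const hGN.norm.aemeasurable
  have hint : Integrable (fun w => ε / 2 +
      Set.indicator {w | ε / 2 ≤ ‖G N w‖} (fun _ => |B|) w) (P N) :=
    (integrable_const _).add ((integrable_const _).indicator₀ hmeas)
  calc ‖∫ w, G N w ∂(P N)‖
      ≤ ∫ w, (ε / 2 + Set.indicator {w | ε / 2 ≤ ‖G N w‖} (fun _ => |B|) w) ∂(P N) := by
        refine norm_integral_le_of_norm_le hint (Eventually.of_forall fun w => ?_)
        by_cases hw : ε / 2 ≤ ‖G N w‖
        · rw [Set.indicator_of_mem (by exact hw)]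
          linarith [hBN w, le_abs_self B]
        · rw [Set.indicator_of_notMem (by exact hw)]
          linarith [not_le.1 hw]
    _ = ε / 2 + (P N).real {w | ε / 2 ≤ ‖G N w‖} * |B| := by
        rw [integral_add (integrable_const _) ((integrable_const _).indicator₀ hmeas),
          integral_indicator₀ hmeas]
        simp
    _ < ε / 2 + ε / 2 := by
        have h3 : (P N).real {w | ε / 2 ≤ ‖G N w‖} < ε / 2 / (|B| + 1) :=
          (ENNReal.lt_ofReal_iff_toReal_lt (measure_ne_top _ _)).1 hN
        rw [lt_div_iff₀ hB1] at h3
        have : (0 : ℝ) ≤ (P N).real {w | ε / 2 ≤ ‖G N w‖} := measureReal_nonneg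
        rcases this.eq_or_lt with h4 | h4
        · rw [← h4]; simpa using hε
        · nlinarith
    _ = ε := add_halves ε

/-! ### Convergence in distribution: test functions, Slutsky, tightness -/

section Distribution

variable [∀ N, IsProbabilityMeasure (P N)] {Ω' : Type*} [MeasurableSpace Ω'] {Q : Measure Ω'}
  [IsProbabilityMeasure Q] {E : Type*} [MeasurableSpace E]

lemma tendstoInDistribution_iff_forall_integral [TopologicalSpace E] [OpensMeasurableSpace E]
    {W : (N : ℕ) → Ω N → E} {V : Ω' → E} (hW : ∀ N, AEMeasurable (W N) (P N))
    (hV : AEMeasurable V Q) :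
    TendstoInDistribution W atTop V P Q ↔ ∀ f : BoundedContinuousFunction E ℝ,
      Tendsto (fun N => ∫ w, f (W N w) ∂(P N)) atTop (𝓝 (∫ w, f (V w) ∂Q)) := by
  have hf : ∀ f : BoundedContinuousFunction E ℝ, Measurable f := fun f => f.continuous.measurable
  have key : ∀ f : BoundedContinuousFunction E ℝ,
      (∀ N, ∫ x, f x ∂((P N).map (W N)) = ∫ w, f (W N w) ∂(P N)) ∧
        ∫ x, f x ∂(Q.map V) = ∫ w, f (V w) ∂Q := fun f =>
    ⟨fun N => integral_map (hW N) (hf f).stronglyMeasurable.aestronglyMeasurable,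
      integral_map hV (hf f).stronglyMeasurable.aestronglyMeasurable⟩
  constructor
  · intro h f
    have := ProbabilityMeasure.tendsto_iff_forall_integral_tendsto.1 h.tendsto f
    simpa [key f] using this
  · intro h
    refine ⟨hW, hV, ProbabilityMeasure.tendsto_iff_forall_integral_tendsto.2 fun f => ?_⟩
    simpa [key f] using h f

lemma MeasureTheory.TendstoInDistribution.tendsto_integral_complex [TopologicalSpace E] [OpensMeasurableSpace E]
    {W : (N : ℕ) → Ω N → E} {V : Ω' → E} (h : TendstoInDistribution W atTop V P Q)
    (f : BoundedContinuousFunction E ℂ) :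
    Tendsto (fun N => ∫ w, f (W N w) ∂(P N)) atTop (𝓝 (∫ w, f (V w) ∂Q)) := by
  have hf : Measurable f := f.continuous.measurable
  have := (ProbabilityMeasure.tendsto_iff_forall_integral_rclike_tendsto ℂ).1 h.tendsto f
  simp only [ProbabilityMeasure.coe_mk] at this
  rw [integral_map h.aemeasurable_limit hf.stronglyMeasurable.aestronglyMeasurable] at this
  refine this.congr fun N => ?_
  rw [integral_map (h.forall_aemeasurable N) hf.stronglyMeasurable.aestronglyMeasurable]

/-- **Slutsky's theorem** on varying probability spaces. -/
lemma MeasureTheory.TendstoInDistribution.of_tendstoZeroInProb_dist [PseudoMetricSpace E] [BorelSpace E]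
    {W W' : (N : ℕ) → Ω N → E} {V : Ω' → E} (h : TendstoInDistribution W atTop V P Q)
    (hW' : ∀ N, AEMeasurable (W' N) (P N))
    (hd : TendstoZeroInProb P (fun N w => dist (W' N w) (W N w))) :
    TendstoInDistribution W' atTop V P Q := by
  refine ⟨hW', h.aemeasurable_limit, tendsto_iff_forall_lipschitz_integral_tendsto.2 ?_⟩
  rintro f ⟨B, hB⟩ ⟨L, hL⟩
  have hfm : Measurable f := hL.continuous.measurable
  have h1 := tendsto_iff_forall_lipschitz_integral_tendsto.1 h.tendsto f ⟨B, hB⟩ ⟨L, hL⟩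
  simp only [ProbabilityMeasure.coe_mk] at h1 ⊢
  -- Boundedness of `f` is given as a bound on its oscillation; a base point turns it into a bound
  -- on the norm, the empty space being treated apart.
  have hbd : ∃ M, ∀ x, ‖f x‖ ≤ M := by
    rcases isEmpty_or_nonempty E with hE | ⟨⟨x0⟩⟩
    · exact ⟨0, fun x => (hE.false x).elim⟩
    · refine ⟨B + ‖f x0‖, fun x => ?_⟩
      have h2 := hB x x0
      rw [dist_eq_norm] at h2
      have := norm_le_norm_add_norm_sub' (f x) (f x0)
      linarith
  obtain ⟨M, hM⟩ := hbd
  have hint : ∀ N {U : Ω N → E}, AEMeasurable U (P N) → Integrable (fun w => f (U w)) (P N) :=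
    fun N U hU => Integrable.of_bound (hfm.comp_aemeasurable hU).aestronglyMeasurable M
      (Eventually.of_forall fun w => hM _)
  have h3 : Tendsto (fun N => ∫ w, (f (W' N w) - f (W N w)) ∂(P N)) atTop (𝓝 0) := by
    refine tendsto_integral_zero_of_tendstoZeroInProb (B := B)
      (Eventually.of_forall fun N => ((hint N (hW' N)).sub
        (hint N (h.forall_aemeasurable N))).aestronglyMeasurable)
      (Eventually.of_forall fun N w => by rw [← dist_eq_norm]; exact hB _ _) ?_
    refine (hd.mul_bounded (boundedInProb_const (L : ℝ))).mono
      (Eventually.of_forall fun N w => ?_)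
    rw [abs_norm, ← dist_eq_norm, abs_of_nonneg (by positivity), mul_comm]
    exact hL.dist_le_mul _ _
  have h4 := h1.add h3
  rw [add_zero] at h4
  refine h4.congr fun N => ?_
  rw [integral_map (hW' N) hfm.stronglyMeasurable.aestronglyMeasurable,
    integral_map (h.forall_aemeasurable N) hfm.stronglyMeasurable.aestronglyMeasurable,
    integral_sub (hint N (hW' N)) (hint N (h.forall_aemeasurable N))]
  ring

/-- The limit law is tight, and the closed-set half of the portmanteau theorem passes a small tail
on to all large `N`. -/
lemma MeasureTheory.TendstoInDistribution.boundedInProb {W : (N : ℕ) → Ω N → ℝ} {V : Ω' → ℝ}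
    (h : TendstoInDistribution W atTop V P Q) : BoundedInProb P W := by
  intro ε hε
  have hlim : Tendsto (fun n : ℕ => Q.map V {x : ℝ | (n : ℝ) ≤ |x|}) atTop (𝓝 0) := by
    have hV := Measure.isProbabilityMeasure_map h.aemeasurable_limit
    have : (⋂ n : ℕ, {x : ℝ | (n : ℝ) ≤ |x|}) = ∅ := by
      ext x
      simp only [Set.mem_iInter, Set.mem_ofPred_eq, Set.mem_empty_iff_false, iff_false, not_forall,
        not_le]
      exact exists_nat_gt |x|
    rw [← measure_empty (μ := Q.map V), ← this]
    refine tendsto_measure_iInter_atTop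
      (fun n => (measurableSet_le measurable_const measurable_norm).nullMeasurableSet) ?_
      ⟨0, measure_ne_top _ _⟩
    intro m n hmn x (hx : (n : ℝ) ≤ |x|)
    exact le_trans (by exact_mod_cast hmn) hx
  obtain ⟨n, hn⟩ := ((tendsto_order.1 hlim).2 ε hε).exists
  have hcl : IsClosed {x : ℝ | (n : ℝ) ≤ |x|} := isClosed_le continuous_const continuous_abs
  have h1 := ProbabilityMeasure.limsup_measure_closed_le_of_tendsto h.tendsto hcl
  simp only [ProbabilityMeasure.coe_mk] at h1
  refine ⟨n, ?_⟩
  filter_upwards [eventually_lt_of_limsup_lt (h1.trans_lt hn)] with N hN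
  rw [Measure.map_apply_of_aemeasurable (h.forall_aemeasurable N) hcl.measurableSet] at hN
  exact hN.le

end Distribution

end ConvergenceInProbability

/-! ### Joint convergence with an integer-valued coordinate -/

section JointConvergence

-- Orthogonality of characters on the circle, which makes it possible to isolate the event that a
-- count equals `k`.
open Complex in
lemma integral_exp_mul_I_nat_sub (m k : ℕ) :
    ∫ v in (0 : ℝ)..2 * Real.pi, cexp (v * m * I) * cexp (-(v * k * I)) =
      if m = k then 2 * Real.pi else 0 := by
  have h1 : ∀ v : ℝ, cexp (v * m * I) * cexp (-(v * k * I)) =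
      cexp ((((m : ℂ) - k) * I) * v) := fun v => by
    rw [← Complex.exp_add]; ring_nf
  simp_rw [h1]
  split_ifs with h
  · simp [h]
  · have hne : ((m : ℂ) - k) * I ≠ 0 :=
      mul_ne_zero (sub_ne_zero.2 (by exact_mod_cast h)) I_ne_zero
    rw [integral_exp_mul_complex hne]
    have h2 : cexp (((m : ℂ) - k) * I * ↑(2 * Real.pi)) = 1 := by
      rw [Complex.exp_eq_one_iff]
      exact ⟨(m : ℤ) - k, by push_cast; ring⟩
    rw [h2]
    simp

lemma norm_cexp_ofReal_mul_natCast_mul_I (v : ℝ) (m : ℕ) :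
    ‖Complex.exp (v * m * Complex.I)‖ = 1 := by
  have := Complex.norm_exp_ofReal_mul_I (v * m)
  push_cast at this
  exact this

lemma hasSum_measureReal_singleton {α : Type*} [Countable α] [MeasurableSpace α]
    [MeasurableSingletonClass α] (μ : Measure α) [IsFiniteMeasure μ] :
    HasSum (fun k => μ.real {k}) (μ.real Set.univ) := by
  have h := Measure.tsum_indicator_apply_singleton μ Set.univ MeasurableSet.univ
  simp only [Set.indicator_univ] at h
  have h2 := ENNReal.hasSum_toReal (f := fun k => μ {k}) (by rw [h]; exact measure_ne_top _ _)
  rwa [← ENNReal.tsum_toReal_eq fun _ => measure_ne_top _ _, h] at h2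

/-- Fourier inversion for the joint law of a bounded variable and a count. -/
lemma integral_mul_indicator_eq_intervalIntegral {Ω : Type*} [MeasurableSpace Ω] (P : Measure Ω)
    [IsFiniteMeasure P] {F : Ω → ℝ} {X : Ω → ℕ} (hF : Measurable F) (hX : Measurable X)
    {B : ℝ} (hB : ∀ w, ‖F w‖ ≤ B) (k : ℕ) :
    2 * Real.pi * ((∫ w, F w * (if X w = k then 1 else 0) ∂P : ℝ) : ℂ) =
      ∫ v in (0 : ℝ)..2 * Real.pi,
        (∫ w, (F w : ℂ) * Complex.exp (v * X w * Complex.I) ∂P) *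
          Complex.exp (-(v * k * Complex.I)) := by
  simp_rw [← integral_mul_const]
  rw [intervalIntegral_integral_swap]
  · rw [← integral_complex_ofReal, ← integral_const_mul]
    refine integral_congr_ae (Eventually.of_forall fun w => ?_)
    simp only [mul_assoc (F w : ℂ)]
    rw [intervalIntegral.integral_const_mul, integral_exp_mul_I_nat_sub]
    split_ifs <;> push_cast <;> ring
  · have : IsFiniteMeasure (volume.restrict (Set.uIoc 0 (2 * Real.pi))) := ⟨by
      rw [Measure.restrict_apply_univ, Set.uIoc_of_le Real.two_pi_pos.le]
      exact measure_Ioc_lt_top⟩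
    refine Integrable.of_bound (C := B) ?_ (Eventually.of_forall fun x => ?_)
    · refine Measurable.aestronglyMeasurable ?_
      have hX' : Measurable fun w => (X w : ℂ) := (measurable_of_countable _).comp hX
      simp only [Function.uncurry_def]
      fun_prop
    · have h2 : ‖Complex.exp (-(x.1 * k * Complex.I))‖ = 1 := by
        rw [Complex.exp_neg, norm_inv, norm_cexp_ofReal_mul_natCast_mul_I, inv_one]
      simp only [Function.uncurry_def, norm_mul, norm_cexp_ofReal_mul_natCast_mul_I, h2, mul_one,
        Complex.norm_real]
      exact hB _

variable {Ω : ℕ → Type*} [∀ N, MeasurableSpace (Ω N)] {P : (N : ℕ) → Measure (Ω N)}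
  [∀ N, IsProbabilityMeasure (P N)] {Ω' : Type*} [MeasurableSpace Ω'] {Q : Measure Ω'}
  [IsProbabilityMeasure Q]

/-- Fourier inversion writes each side as an integral over the compact interval `[0, 2π]` of
functions bounded by `B`, so pointwise convergence in `v` suffices by dominated convergence. -/
lemma tendsto_integral_mul_indicator {F : (N : ℕ) → Ω N → ℝ} {F' : Ω' → ℝ}
    {X : (N : ℕ) → Ω N → ℕ} {X' : Ω' → ℕ} (hF : ∀ N, Measurable (F N)) (hF' : Measurable F')
    (hX : ∀ N, Measurable (X N)) (hX' : Measurable X') {B : ℝ} (hB : ∀ N w, ‖F N w‖ ≤ B)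
    (hB' : ∀ w, ‖F' w‖ ≤ B)
    (h : ∀ v : ℝ, Tendsto (fun N => ∫ w, (F N w : ℂ) * Complex.exp (v * X N w * Complex.I) ∂(P N))
      atTop (𝓝 (∫ w, (F' w : ℂ) * Complex.exp (v * X' w * Complex.I) ∂Q))) (k : ℕ) :
    Tendsto (fun N => ∫ w, F N w * (if X N w = k then 1 else 0) ∂(P N)) atTop
      (𝓝 (∫ w, F' w * (if X' w = k then 1 else 0) ∂Q)) := by
  have hpi : (2 * Real.pi : ℂ) ≠ 0 := by
    exact_mod_cast (mul_pos two_pos Real.pi_pos).ne'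
  have key : Tendsto
      (fun N => 2 * Real.pi * ((∫ w, F N w * (if X N w = k then 1 else 0) ∂(P N) : ℝ) : ℂ)) atTop
      (𝓝 (2 * Real.pi * ((∫ w, F' w * (if X' w = k then 1 else 0) ∂Q : ℝ) : ℂ))) := by
    rw [integral_mul_indicator_eq_intervalIntegral Q hF' hX' hB']
    simp_rw [fun N => integral_mul_indicator_eq_intervalIntegral (P N) (hF N) (hX N) (hB N) k]
    refine intervalIntegral.tendsto_integral_filter_of_dominated_convergence (fun _ => B)
      (Eventually.of_forall fun N => ?_) (Eventually.of_forall fun N =>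
        Eventually.of_forall fun v _ => ?_) intervalIntegrable_const
      (Eventually.of_forall fun v _ => (h v).mul_const _)
    · refine AEStronglyMeasurable.mul (StronglyMeasurable.aestronglyMeasurable ?_)
        (by fun_prop)
      refine StronglyMeasurable.integral_prod_right ?_
      have hX1 : Measurable fun w => (X N w : ℂ) := (measurable_of_countable _).comp (hX N)
      have hF1 := hF N
      refine Measurable.stronglyMeasurable ?_
      simp only [Function.uncurry_def]
      fun_prop
    · have h2 : ‖Complex.exp (-(v * k * Complex.I))‖ = 1 := by
        rw [Complex.exp_neg, norm_inv, norm_cexp_ofReal_mul_natCast_mul_I, inv_one]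
      rw [norm_mul, h2, mul_one]
      refine (norm_integral_le_of_norm_le_const (C := B)
        (Eventually.of_forall fun w => ?_)).trans (by simp)
      rw [norm_mul, norm_cexp_ofReal_mul_natCast_mul_I, mul_one, Complex.norm_real]
      exact hB N w
  have h3 := (Complex.continuous_re.tendsto _).comp (key.const_mul (2 * Real.pi : ℂ)⁻¹)
  simpa only [Function.comp_def, inv_mul_cancel_left₀ hpi, Complex.ofReal_re] using h3

/-- The sum reproduces `G` where `X < K` and vanishes elsewhere, so the error is at most `B` times
the tail mass. Writing that mass through finitely many point probabilities lets the bound converge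
as `N → ∞` for fixed `K`. -/
lemma abs_integral_sub_sum_indicator_le {Ω : Type*} [MeasurableSpace Ω] (P : Measure Ω)
    [IsProbabilityMeasure P] {G : Ω → ℝ} {g : ℕ → Ω → ℝ} {X : Ω → ℕ} (hG : Measurable G)
    (hg : ∀ k, Measurable (g k)) (hX : Measurable X) {B : ℝ} (hB : ∀ w, ‖G w‖ ≤ B)
    (hgB : ∀ k w, ‖g k w‖ ≤ B) (hGg : ∀ w, G w = g (X w) w) (K : ℕ) :
    |∫ w, G w ∂P - ∑ k ∈ Finset.range K, ∫ w, g k w * (if X w = k then 1 else 0) ∂P| ≤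
      B * (1 - ∑ k ∈ Finset.range K, ∫ w, 1 * (if X w = k then (1 : ℝ) else 0) ∂P) := by
  have hind : ∀ k, Measurable fun w => if X w = k then (1 : ℝ) else 0 := fun k =>
    Measurable.ite (hX (measurableSet_singleton k)) measurable_const measurable_const
  have hi1 : ∀ k, Integrable (fun w => g k w * (if X w = k then 1 else 0)) P := fun k =>
    Integrable.of_bound ((hg k).mul (hind k)).aestronglyMeasurable B
      (Eventually.of_forall fun w => by
        have := hgB k w
        have h0 := (norm_nonneg _).trans this
        split_ifs <;> simp_all)
  have hi2 : ∀ k, Integrable (fun w => (1 : ℝ) * (if X w = k then 1 else 0)) P := fun k =>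
    Integrable.of_bound ((hind k).const_mul 1).aestronglyMeasurable 1
      (Eventually.of_forall fun w => by split_ifs <;> simp)
  have hiG : Integrable G P :=
    Integrable.of_bound hG.aestronglyMeasurable B (Eventually.of_forall hB)
  have hsum : ∀ w (u : ℕ → ℝ), ∑ k ∈ Finset.range K, u k * (if X w = k then 1 else 0) =
      if X w < K then u (X w) else 0 := fun w u => by
    simp [Finset.sum_ite_eq, Finset.mem_range]
  rw [← integral_finsetSum _ fun k _ => hi1 k, ← integral_finsetSum _ fun k _ => hi2 k,
    ← integral_sub hiG (integrable_finsetSum _ fun k _ => hi1 k)]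
  have h1 : 1 - ∫ w, ∑ k ∈ Finset.range K, (1 : ℝ) * (if X w = k then 1 else 0) ∂P =
      ∫ w, (1 - ∑ k ∈ Finset.range K, (1 : ℝ) * (if X w = k then 1 else 0)) ∂P := by
    rw [integral_sub (integrable_const _) (integrable_finsetSum _ fun k _ => hi2 k)]
    simp
  rw [h1, ← integral_const_mul, ← Real.norm_eq_abs]
  refine norm_integral_le_of_norm_le (((integrable_const _).sub
    (integrable_finsetSum _ fun k _ => hi2 k)).const_mul B) (Eventually.of_forall fun w => ?_)
  have e1 := hsum w (fun k => g k w)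
  have e2 := hsum w (fun _ => 1)
  simp only [e1, e2]
  split_ifs
  · simp [hGg w]
  · simpa using hB w

/-- Joint convergence in distribution of a random variable and a count from convergence of the
characteristic function of the count weighted by test functions of the first variable. -/
theorem tendstoInDistribution_prodMk_nat {E : Type*} [TopologicalSpace E]
    [SecondCountableTopology E] [MeasurableSpace E] [BorelSpace E]
    {Z : (N : ℕ) → Ω N → E} {Z' : Ω' → E} {X : (N : ℕ) → Ω N → ℕ} {X' : Ω' → ℕ}
    (hZ : ∀ N, Measurable (Z N)) (hZ' : Measurable Z') (hX : ∀ N, Measurable (X N))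
    (hX' : Measurable X')
    (h : ∀ (f : BoundedContinuousFunction E ℝ) (v : ℝ),
      Tendsto (fun N => ∫ w, (f (Z N w) : ℂ) * Complex.exp (v * X N w * Complex.I) ∂(P N)) atTop
        (𝓝 (∫ w, (f (Z' w) : ℂ) * Complex.exp (v * X' w * Complex.I) ∂Q))) :
    TendstoInDistribution (fun N w => (Z N w, X N w)) atTop (fun w => (Z' w, X' w)) P Q := by
  rw [tendstoInDistribution_iff_forall_integral
    (fun N => ((hZ N).prodMk (hX N)).aemeasurable) (hZ'.prodMk hX').aemeasurable]
  intro F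
  -- The constant test function gives convergence of the point probabilities of the count, which
  -- controls the tails.
  have hone := fun k => tendsto_integral_mul_indicator (F := fun N _ => 1) (F' := fun _ => 1)
    (P := P) (Q := Q) (X := X) (X' := X') (B := 1)
    (fun _ => measurable_const) measurable_const hX hX' (by simp) (by simp)
    (fun v => by simpa using h (BoundedContinuousFunction.const E 1) v) k
  let f : ℕ → BoundedContinuousFunction E ℝ := fun k =>
    F.compContinuous ⟨fun x => (x, k), by fun_prop⟩
  have hfm : ∀ k, Measurable (f k) := fun k => (f k).continuous.measurable
  have hFm : Measurable F := F.continuous.measurable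
  have hfk := fun k => tendsto_integral_mul_indicator (F := fun N w => f k (Z N w))
    (F' := fun w => f k (Z' w)) (P := P) (Q := Q) (X := X) (X' := X') (B := ‖F‖)
    (fun N => (hfm k).comp (hZ N)) ((hfm k).comp hZ') hX hX' (fun N w => F.norm_coe_le_norm _)
    (fun w => F.norm_coe_le_norm _) (h (f k)) k
  have hbN := fun N => abs_integral_sub_sum_indicator_le (P N) (G := fun w => F (Z N w, X N w))
    (g := fun k w => f k (Z N w)) (hFm.comp ((hZ N).prodMk (hX N))) (fun k => (hfm k).comp (hZ N))
    (hX N) (fun w => F.norm_coe_le_norm _) (fun k w => F.norm_coe_le_norm _) (fun w => rfl)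
  have hb' := abs_integral_sub_sum_indicator_le Q (G := fun w => F (Z' w, X' w))
    (g := fun k w => f k (Z' w)) (hFm.comp (hZ'.prodMk hX')) (fun k => (hfm k).comp hZ')
    hX' (fun w => F.norm_coe_le_norm _) (fun k w => F.norm_coe_le_norm _) (fun w => rfl)
  have htail : Tendsto (fun K => ‖F‖ * (1 - ∑ k ∈ Finset.range K,
      ∫ w, 1 * (if X' w = k then (1 : ℝ) else 0) ∂Q)) atTop (𝓝 0) := by
    have hs : HasSum (fun k => ∫ w, 1 * (if X' w = k then (1 : ℝ) else 0) ∂Q) 1 := by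
      have e : ∀ k, ∫ w, 1 * (if X' w = k then (1 : ℝ) else 0) ∂Q = (Q.map X').real {k} := by
        intro k
        rw [map_measureReal_apply hX' (measurableSet_singleton k),
          ← integral_indicator_one (hX' (measurableSet_singleton k))]
        refine integral_congr_ae (Eventually.of_forall fun w => ?_)
        by_cases hw : X' w = k <;> simp [hw]
      simp_rw [e]
      have := Measure.isProbabilityMeasure_map (μ := Q) hX'.aemeasurable
      have h5 := hasSum_measureReal_singleton (Q.map X')
      simpa using h5
    have := (hs.tendsto_sum_nat.const_sub 1).const_mul ‖F‖
    simpa using this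
  rw [Metric.tendsto_nhds]
  intro ε hε
  -- The cutoff is chosen from the limit law alone and serves all large `N`. Three errors of at most
  -- `ε / 4` remain: two tails and the truncated sums.
  obtain ⟨K, hK⟩ := ((tendsto_order.1 htail).2 (ε / 4) (by positivity)).exists
  have hsN := tendsto_finsetSum (Finset.range K) fun k _ => hfk k
  have hoN := ((tendsto_finsetSum (Finset.range K) fun k _ => hone k).const_sub 1).const_mul ‖F‖
  filter_upwards [(Metric.tendsto_nhds.1 hsN) (ε / 4) (by positivity),
    (tendsto_order.1 hoN).2 (ε / 4) hK] with N h1 h2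
  have h3 := (hbN N K).trans h2.le
  have h4 := (hb' K).trans hK.le
  rw [Real.dist_eq] at h1 ⊢
  rw [abs_lt] at h1 ⊢
  rw [abs_le] at h3 h4
  constructor <;> linarith [h1.1, h1.2, h3.1, h3.2, h4.1, h4.2]

end JointConvergence

/-! ### Poisson approximation of Bernoulli sums by characteristic functions -/

section BernoulliSums

open Complex in
lemma norm_one_add_mul_exp_sub_one_le {p : ℝ} (hp : p ∈ Set.Icc (0 : ℝ) 1) (v : ℝ) :
    ‖1 + p * (cexp (v * I) - 1)‖ ≤ 1 := by
  have h : (1 + p * (cexp (v * I) - 1) : ℂ) = ((1 - p : ℝ) : ℂ) + (p : ℂ) * cexp (v * I) := by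
    push_cast; ring
  rw [h]
  refine (norm_add_le _ _).trans ?_
  rw [norm_mul, norm_exp_ofReal_mul_I, Complex.norm_real, Complex.norm_real,
    Real.norm_of_nonneg hp.1, Real.norm_of_nonneg (by linarith [hp.2])]
  linarith

lemma re_exp_ofReal_mul_I_sub_one_nonpos (v : ℝ) :
    (Complex.exp (v * Complex.I) - 1).re ≤ 0 := by
  rw [Complex.sub_re, Complex.exp_ofReal_mul_I_re, Complex.one_re]
  linarith [Real.cos_le_one v]

lemma norm_exp_ofReal_mul_le_one {s : ℝ} (hs : 0 ≤ s) {z : ℂ} (hz : z.re ≤ 0) :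
    ‖Complex.exp (s * z)‖ ≤ 1 := by
  rw [Complex.norm_exp, Real.exp_le_one_iff, Complex.re_ofReal_mul]
  exact mul_nonpos_of_nonneg_of_nonpos hs hz

/-- Mean value inequality on the half-line, where the derivative has norm at most `‖z‖` because the
real part of `z` is nonpositive. -/
lemma norm_exp_ofReal_mul_sub_exp_le {s r : ℝ} (hs : 0 ≤ s) (hr : 0 ≤ r) {z : ℂ}
    (hz : z.re ≤ 0) :
    ‖Complex.exp (s * z) - Complex.exp (r * z)‖ ≤ ‖z‖ * |s - r| := by
  have hd : ∀ x ∈ Set.Ici (0 : ℝ), HasDerivWithinAt (fun u : ℝ => Complex.exp (u * z))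
      (Complex.exp (x * z) * z) (Set.Ici 0) x := fun x _ => by
    have h1 : HasDerivAt (fun u : ℝ => (u : ℂ) * z) z x := by
      simpa using (HasDerivAt.ofReal_comp (hasDerivAt_id x)).mul_const z
    exact h1.cexp.hasDerivWithinAt
  have hb : ∀ x ∈ Set.Ici (0 : ℝ), ‖Complex.exp (x * z) * z‖ ≤ ‖z‖ := fun x hx => by
    rw [norm_mul]
    exact mul_le_of_le_one_left (norm_nonneg _) (norm_exp_ofReal_mul_le_one hx hz)
  have := (convex_Ici (0 : ℝ)).norm_image_sub_le_of_norm_hasDerivWithin_le hd hb hr hs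
  simpa using this

/-- Telescoping: factors are exchanged one at a time, the others having norm at most one. -/
lemma norm_prod_sub_prod_le_sum {ι : Type*} (s : Finset ι) (f g : ι → ℂ)
    (hf : ∀ i, ‖f i‖ ≤ 1) (hg : ∀ i, ‖g i‖ ≤ 1) :
    ‖∏ i ∈ s, f i - ∏ i ∈ s, g i‖ ≤ ∑ i ∈ s, ‖f i - g i‖ := by
  classical
  induction s using Finset.induction_on with
  | empty => simp
  | insert a s ha ih =>
    rw [Finset.prod_insert ha, Finset.prod_insert ha, Finset.sum_insert ha]
    have h1 : ‖∏ i ∈ s, g i‖ ≤ 1 := by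
      rw [norm_prod]
      exact Finset.prod_le_one (fun i _ => norm_nonneg _) fun i _ => hg i
    have h2 : f a * ∏ i ∈ s, f i - g a * ∏ i ∈ s, g i =
        (f a - g a) * ∏ i ∈ s, g i + f a * (∏ i ∈ s, f i - ∏ i ∈ s, g i) := by ring
    rw [h2]
    refine (norm_add_le _ _).trans ?_
    rw [norm_mul, norm_mul]
    exact add_le_add (mul_le_of_le_one_right (norm_nonneg _) h1)
      ((mul_le_of_le_one_left (norm_nonneg _) (hf a)).trans ih)

/-- For `p ≤ 1/2` one has `‖p z‖ ≤ 1`, and the second-order remainder of the exponential is at most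
`4 p ^ 2`. For `p > 1/2` the trivial bound `2` is below `8 p ^ 2`, whence the constant. -/
lemma norm_one_add_sub_exp_le {p : ℝ} (hp : p ∈ Set.Icc (0 : ℝ) 1) {z : ℂ} (hz : z.re ≤ 0)
    (hz2 : ‖z‖ ≤ 2) (hz1 : ‖1 + p * z‖ ≤ 1) :
    ‖(1 + p * z) - Complex.exp (p * z)‖ ≤ 8 * p ^ 2 := by
  have hpz : ‖(p : ℂ) * z‖ ≤ 2 * p := by
    rw [norm_mul, Complex.norm_real, Real.norm_of_nonneg hp.1]
    nlinarith [hp.1]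
  rcases le_or_gt p (1 / 2) with h | h
  · have h1 := Complex.norm_exp_sub_one_sub_id_le (x := (p : ℂ) * z) (by linarith)
    rw [← norm_neg] at h1
    calc _ = ‖-(Complex.exp (p * z) - 1 - p * z)‖ := by congr 1; ring
      _ ≤ _ := h1
      _ ≤ (2 * p) ^ 2 := by gcongr
      _ ≤ 8 * p ^ 2 := by nlinarith [sq_nonneg p]
  · refine (norm_sub_le _ _).trans ?_
    have := norm_exp_ofReal_mul_le_one hp.1 hz
    nlinarith

lemma norm_exp_mul_I_sub_one_le_two (v : ℝ) : ‖Complex.exp (v * Complex.I) - 1‖ ≤ 2 := by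
  refine (norm_sub_le _ _).trans ?_
  rw [Complex.norm_exp_ofReal_mul_I, norm_one]
  norm_num

/-- The characteristic function of a sum of independent Bernoulli variables is close to the
Poisson one. -/
lemma norm_prod_bernoulli_sub_exp_le {ι : Type*} [Fintype ι] {p : ι → ℝ}
    (hp : ∀ i, p i ∈ Set.Icc (0 : ℝ) 1) {D : ℝ} (hD : ∀ i, p i ≤ D) (v : ℝ) :
    ‖∏ i, (1 + p i * (Complex.exp (v * Complex.I) - 1)) -
        Complex.exp ((∑ i, p i : ℝ) * (Complex.exp (v * Complex.I) - 1))‖ ≤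
      8 * (D * ∑ i, p i) := by
  have hz := re_exp_ofReal_mul_I_sub_one_nonpos v
  have h1 : Complex.exp ((∑ i, p i : ℝ) * (Complex.exp (v * Complex.I) - 1)) =
      ∏ i, Complex.exp (p i * (Complex.exp (v * Complex.I) - 1)) := by
    rw [← Complex.exp_sum, ← Finset.sum_mul]
    push_cast
    rfl
  rw [h1]
  refine (norm_prod_sub_prod_le_sum _ _ _ (fun i => norm_one_add_mul_exp_sub_one_le (hp i) v)
    (fun i => norm_exp_ofReal_mul_le_one (hp i).1 hz)).trans ?_
  rw [Finset.mul_sum, Finset.mul_sum]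
  refine Finset.sum_le_sum fun i _ => (norm_one_add_sub_exp_le (hp i) hz
    (norm_exp_mul_I_sub_one_le_two v) (norm_one_add_mul_exp_sub_one_le (hp i) v)).trans ?_
  nlinarith [(hp i).1, hD i]

/-- Each factor on the right is a two-term sum over `Bool`; distributing the product gives one term
per outcome vector. -/
lemma sum_exp_card_mul_prod_bernoulli {N : ℕ} (p : Fin N → ℝ) (v : ℝ) :
    ∑ b : Fin N → Bool, Complex.exp (v * (∑ i, (b i).toNat : ℕ) * Complex.I) *
        ((∏ i, if b i = true then p i else 1 - p i : ℝ) : ℂ) =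
      ∏ i, (1 + p i * (Complex.exp (v * Complex.I) - 1)) := by
  have h1 : ∀ i, (1 + p i * (Complex.exp (v * Complex.I) - 1) : ℂ) =
      ∑ b : Bool, Complex.exp (v * b.toNat * Complex.I) *
        ((if b = true then p i else 1 - p i : ℝ) : ℂ) := fun i => by
    simp
    ring
  simp_rw [h1]
  rw [Finset.prod_univ_sum, Fintype.piFinset_univ]
  refine Finset.sum_congr rfl fun b _ => ?_
  rw [Finset.prod_mul_distrib, ← Complex.exp_sum, Complex.ofReal_prod]
  congr 2
  push_cast
  rw [← Finset.sum_mul, ← Finset.mul_sum]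

end BernoulliSums

/-! ### Conditional probabilities under the integral -/

section ConditionalExpectation

/-- Integrating against a bounded variable known at the conditioning date replaces an indicator by
its conditional probability. -/
lemma integral_mul_indicator_eq_of_condExp {Ω : Type*} {m : MeasurableSpace Ω}
    [mΩ : MeasurableSpace Ω] (P : Measure Ω) [IsProbabilityMeasure P] (hm : m ≤ mΩ)
    {F : Ω → ℝ} (hF : Measurable[m] F) {B : ℝ} (hB : ∀ w, ‖F w‖ ≤ B) {A : Set Ω}
    (hA : MeasurableSet A) {g : Ω → ℝ} (hg : P⟦A | m⟧ =ᵐ[P] g) :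
    ∫ w, F w * A.indicator (fun _ => (1 : ℝ)) w ∂P = ∫ w, F w * g w ∂P := by
  have hi : Integrable (A.indicator fun _ => (1 : ℝ)) P := (integrable_const _).indicator hA
  have hFi : Integrable (F * A.indicator fun _ => (1 : ℝ)) P :=
    hi.bdd_mul (hF.mono hm le_rfl).aestronglyMeasurable (Eventually.of_forall hB)
  have h1 := condExp_mul_of_stronglyMeasurable_left hF.stronglyMeasurable hFi hi
  rw [← integral_condExp hm (f := fun w => F w * A.indicator (fun _ => (1 : ℝ)) w)]
  refine integral_congr_ae (h1.trans ?_)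
  filter_upwards [hg] with w hw
  simp only [Pi.mul_apply]
  rw [← hw]

end ConditionalExpectation

/-! ### The binary panel and its conditional characteristic function -/

section Panel

variable {Ω : Type*} {N : ℕ} {y : Fin N → ℕ → Ω → Bool} {p : Fin N → ℕ → Ω → ℝ}

lemma measurable_aggregateCount [MeasurableSpace Ω] (hy : ∀ i t, Measurable (y i t)) (t : ℕ) :
    Measurable (aggregateCount y t) := by
  unfold aggregateCount
  exact Finset.measurable_sum _ fun i _ => (measurable_of_countable Bool.toNat).comp (hy i t)

lemma panelPast_le [mΩ : MeasurableSpace Ω] (hy : ∀ i t, Measurable (y i t)) (hp : ∀ i t, Measurable (p i t)) (t : ℕ) :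
    panelPast y p t ≤ mΩ := by
  refine sup_le (iSup_le fun j => (hp j 0).comap_le) ?_
  exact iSup₂_le fun s _ => iSup_le fun j => (hy j s).comap_le

lemma measurable_panelPast_initial (t : ℕ) (i : Fin N) : Measurable[panelPast y p t] (p i 0) :=
  measurable_iff_comap_le.2 ((le_iSup (fun j => MeasurableSpace.comap (p j 0) _) i).trans
    le_sup_left)

lemma measurable_panelPast_outcome {s t : ℕ} (hst : s < t) (i : Fin N) :
    Measurable[panelPast y p t] (y i s) :=
  measurable_iff_comap_le.2 (((le_iSup (fun j => MeasurableSpace.comap (y j s) _) i).trans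
    (le_iSup₂ (f := fun s (_ : s ∈ Finset.range t) =>
      ⨆ j, MeasurableSpace.comap (y j s) inferInstance) s (Finset.mem_range.2 hst))).trans
    le_sup_right)

namespace InteractiveGAB

variable [MeasurableSpace Ω] {P : Measure Ω} {ω α γ β : Fin N → ℝ}

/-- The coefficients are nonnegative with sum at most one, and the outcome, the panel mean and the
previous probability all lie in `[0, 1]`. -/
lemma prob_mem (h : InteractiveGAB P ω α γ β y p) (i : Fin N) (t : ℕ) (w : Ω) : p i t w ∈ Set.Icc (0 : ℝ) 1 := by
  induction t with
  | zero => exact h.initial_mem i w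
  | succ t ih =>
    have hN : (0 : ℝ) < N := by exact_mod_cast i.pos
    have hy1 : ∀ j, ((y j t w).toNat : ℝ) ≤ 1 := fun j => by
      exact_mod_cast Bool.toNat_le (y j t w)
    have hm0 : 0 ≤ 1 / (N : ℝ) * ∑ j, ((y j t w).toNat : ℝ) := by positivity
    have hm1 : 1 / (N : ℝ) * ∑ j, ((y j t w).toNat : ℝ) ≤ 1 := by
      rw [one_div, inv_mul_le_iff₀ hN, mul_one]
      refine (Finset.sum_le_sum fun j _ => hy1 j).trans ?_
      simp
    have h1 := h.omega_nonneg i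
    have h2 := h.alpha_nonneg i
    have h3 := h.gamma_nonneg i
    have h4 := h.beta_nonneg i
    have h5 := h.sum_le_one i
    rw [h.recursion i t w]
    constructor
    · have := ih.1
      positivity
    · have e1 := mul_le_of_le_one_right h2 (hy1 i)
      have e2 := mul_le_of_le_one_right h3 hm1
      have e3 := mul_le_of_le_one_right h4 ih.2
      linarith


/-- The conditional characteristic function of the aggregate count given the past. -/
lemma integral_mul_exp_aggregateCount [IsProbabilityMeasure P]
    (h : InteractiveGAB P ω α γ β y p) (t : ℕ) {F : Ω → ℝ} (hF : Measurable[panelPast y p t] F)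
    {B : ℝ} (hB : ∀ w, ‖F w‖ ≤ B) (v : ℝ) :
    ∫ w, (F w : ℂ) * Complex.exp (v * aggregateCount y t w * Complex.I) ∂P =
      ∫ w, (F w : ℂ) * ∏ i, (1 + p i t w * (Complex.exp (v * Complex.I) - 1)) ∂P := by
  have hm := panelPast_le h.measurable_y h.measurable_p t
  have hFm : Measurable F := hF.mono hm le_rfl
  have hyt : Measurable fun w i => y i t w := measurable_pi_lambda _ fun i => h.measurable_y i t
  have hA : ∀ b : Fin N → Bool, MeasurableSet {w | ∀ i, y i t w = b i} := fun b => by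
    have : {w | ∀ i, y i t w = b i} = (fun w i => y i t w) ⁻¹' {b} := by
      ext w; simp [funext_iff]
    rw [this]
    exact hyt (measurableSet_singleton b)
  have hprod : ∀ b : Fin N → Bool,
      Measurable fun w => ∏ i, if b i = true then p i t w else 1 - p i t w := fun b => by
    refine Finset.measurable_prod _ fun i _ => ?_
    have := h.measurable_p i t
    split_ifs <;> fun_prop
  have hprod1 : ∀ (b : Fin N → Bool) w,
      ‖∏ i, if b i = true then p i t w else 1 - p i t w‖ ≤ 1 := fun b w => by
    rw [norm_prod]
    refine Finset.prod_le_one (fun i _ => norm_nonneg _) fun i _ => ?_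
    have := h.prob_mem i t w
    rw [Real.norm_eq_abs, abs_le]
    split_ifs <;> constructor <;> linarith [this.1, this.2]
  have key := fun b => integral_mul_indicator_eq_of_condExp P hm hF hB (hA b) (h.condLaw t b)
  -- Splitting according to the whole outcome vector leaves only the events whose conditional
  -- probabilities the model specifies.
  have e1 : ∀ w, (F w : ℂ) * Complex.exp (v * aggregateCount y t w * Complex.I) =
      ∑ b : Fin N → Bool, Complex.exp (v * (∑ i, (b i).toNat : ℕ) * Complex.I) *
        ((F w * Set.indicator {w | ∀ i, y i t w = b i} (fun _ => (1 : ℝ)) w : ℝ) : ℂ) := fun w => by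
    rw [Finset.sum_eq_single fun i => y i t w]
    · rw [Set.indicator_of_mem (by intro i; rfl), mul_one, mul_comm]
      rfl
    · intro b _ hb
      rw [Set.indicator_of_notMem, mul_zero, Complex.ofReal_zero, mul_zero]
      exact fun hw => hb (funext fun i => (hw i).symm)
    · simp
  have e2 : ∀ w, (F w : ℂ) * ∏ i, (1 + p i t w * (Complex.exp (v * Complex.I) - 1)) =
      ∑ b : Fin N → Bool, Complex.exp (v * (∑ i, (b i).toNat : ℕ) * Complex.I) *
        ((F w * ∏ i, (if b i = true then p i t w else 1 - p i t w) : ℝ) : ℂ) := fun w => by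
    rw [← sum_exp_card_mul_prod_bernoulli (fun i => p i t w) v, Finset.mul_sum]
    refine Finset.sum_congr rfl fun b _ => ?_
    push_cast
    ring
  simp_rw [e1, e2]
  rw [integral_finsetSum, integral_finsetSum]
  · refine Finset.sum_congr rfl fun b _ => ?_
    rw [integral_const_mul, integral_const_mul, integral_complex_ofReal, integral_complex_ofReal,
      key b]
  · refine fun b _ => (Integrable.ofReal ?_).const_mul _
    refine Integrable.of_bound (hFm.mul (hprod b)).aestronglyMeasurable B
      (Eventually.of_forall fun w => ?_)
    refine (norm_mul_le _ _).trans ?_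
    exact (mul_le_of_le_one_right (norm_nonneg _) (hprod1 b w)).trans (hB w)
  · refine fun b _ => (Integrable.ofReal ?_).const_mul _
    refine Integrable.of_bound
      (hFm.mul (measurable_const.indicator (hA b))).aestronglyMeasurable B
      (Eventually.of_forall fun w => ?_)
    refine (norm_mul_le _ _).trans ?_
    refine (mul_le_of_le_one_right (norm_nonneg _) ?_).trans (hB w)
    by_cases hw : ∀ i, y i t w = b i <;> simp [Set.indicator, hw]

end InteractiveGAB

end Panel

/-! ### Poisson autoregressions: conditional laws and existence -/

section PoissonAutoregression

lemma hasSum_exp_mul_poissonMeasure (r : ℝ≥0) (v : ℝ) :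
    HasSum (fun k : ℕ => Complex.exp (v * k * Complex.I) * ((poissonMeasure r).real {k} : ℂ))
      (Complex.exp (r * (Complex.exp (v * Complex.I) - 1))) := by
  have hi : Integrable (fun k : ℕ => Complex.exp (v * k * Complex.I)) (poissonMeasure r) :=
    Integrable.of_bound Measurable.of_discrete.aestronglyMeasurable 1
      (Eventually.of_forall fun k => (norm_cexp_ofReal_mul_natCast_mul_I v k).le)
  have h1 := hasSum_integral_poissonMeasure hi
  have h2 := charFun_map_cast_poissonMeasure r v
  rw [charFun_apply_real, integral_map Measurable.of_discrete.aemeasurable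
    (by fun_prop)] at h2
  push_cast at h2
  rw [h2] at h1
  refine Eq.mp (congrArg (HasSum · _) (funext fun k => ?_)) h1
  rw [poissonMeasure_real_singleton, Complex.real_smul, mul_comm]

/-- Termwise integration of a bounded weight against a randomized probability on `ℕ`. -/
lemma hasSum_integral_exp_mul {Ω : Type*} [MeasurableSpace Ω] (P : Measure Ω)
    [IsProbabilityMeasure P] {F : Ω → ℝ} (hF : Measurable F) {B : ℝ} (hB : ∀ w, ‖F w‖ ≤ B)
    {q : ℕ → Ω → ℝ} (hq : ∀ k, Measurable (q k)) (hq0 : ∀ k w, 0 ≤ q k w)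
    (hq1 : ∀ w, HasSum (fun k => q k w) 1) (v : ℝ) {G : Ω → ℂ}
    (hG : ∀ w, HasSum (fun k : ℕ => Complex.exp (v * k * Complex.I) * (q k w : ℂ)) (G w)) :
    HasSum (fun k : ℕ => Complex.exp (v * k * Complex.I) * ((∫ w, F w * q k w ∂P : ℝ) : ℂ))
      (∫ w, (F w : ℂ) * G w ∂P) := by
  have h := hasSum_integral_of_dominated_convergence (μ := P)
    (F := fun (k : ℕ) w => Complex.exp (v * k * Complex.I) * ((F w * q k w : ℝ) : ℂ))
    (f := fun w => (F w : ℂ) * G w) (fun k w => B * q k w) (fun k => ?_)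
    (fun k => Eventually.of_forall fun w => ?_)
    (Eventually.of_forall fun w => ((hq1 w).mul_left B).summable) ?_
    (Eventually.of_forall fun w => ?_)
  · refine Eq.mp (congrArg (HasSum · _) (funext fun k => ?_)) h
    rw [integral_const_mul, integral_complex_ofReal]
  · have := hq k
    exact Measurable.aestronglyMeasurable (by fun_prop)
  · rw [norm_mul, norm_cexp_ofReal_mul_natCast_mul_I, one_mul, Complex.norm_real, norm_mul,
      Real.norm_of_nonneg (hq0 k w)]
    exact mul_le_mul_of_nonneg_right (hB w) (hq0 k w)
  · have : (fun w => ∑' k, B * q k w) = fun _ => B := by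
      funext w
      rw [((hq1 w).mul_left B).tsum_eq, mul_one]
    rw [this]
    exact integrable_const B
  · refine Eq.mp (congrArg (HasSum · _) (funext fun k => ?_)) ((hG w).mul_left (F w : ℂ))
    push_cast
    ring

/-- Countable additivity reduces to points, whose masses are explicit functions of `r`. This makes
the Poisson family a kernel. -/
lemma measurable_poissonMeasure_real (A : Set ℕ) :
    Measurable fun r : ℝ≥0 => (poissonMeasure r).real A := by
  have h : ∀ r : ℝ≥0, (poissonMeasure r).real A =
      (∑' n, A.indicator (fun n => ENNReal.ofReal (Real.exp (-r) * r ^ n / n.factorial)) n).toReal :=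
    fun r => by
      rw [measureReal_def, ← Measure.tsum_indicator_apply_singleton _ A MeasurableSet.of_discrete]
      simp_rw [poissonMeasure_singleton]
  simp_rw [h]
  refine (Measurable.tsum fun n => ?_).ennreal_toReal
  by_cases hn : n ∈ A
  · simp only [Set.indicator_of_mem hn]
    fun_prop
  · simp only [Set.indicator_of_notMem hn, measurable_const]

lemma countPast_le {Ω : Type*} [mΩ : MeasurableSpace Ω] {X : ℕ → Ω → ℕ} {lam : ℕ → Ω → ℝ≥0}
    (hX : ∀ t, Measurable (X t)) (hl : Measurable (lam 0)) (t : ℕ) : countPast X lam t ≤ mΩ :=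
  sup_le hl.comap_le (iSup₂_le fun s _ => (hX s).comap_le)

lemma measurable_countPast_initial {Ω : Type*} {X : ℕ → Ω → ℕ} {lam : ℕ → Ω → ℝ≥0} (t : ℕ) :
    Measurable[countPast X lam t] (lam 0) :=
  measurable_iff_comap_le.2 le_sup_left

lemma measurable_countPast_count {Ω : Type*} {X : ℕ → Ω → ℕ} {lam : ℕ → Ω → ℝ≥0} {s t : ℕ}
    (hst : s < t) : Measurable[countPast X lam t] (X s) :=
  measurable_iff_comap_le.2 ((le_iSup₂ (f := fun s (_ : s ∈ Finset.range t) =>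
      MeasurableSpace.comap (X s) inferInstance) s (Finset.mem_range.2 hst)).trans le_sup_right)

namespace PoissonAutoregression

/-- The conditional characteristic function of the count given the past. -/
lemma integral_mul_exp {Ω : Type*} [MeasurableSpace Ω] {Q : Measure Ω} [IsProbabilityMeasure Q]
    {c g b : ℝ} {X : ℕ → Ω → ℕ} {lam : ℕ → Ω → ℝ≥0} (h : PoissonAutoregression Q c g b X lam)
    (t : ℕ) {F : Ω → ℝ} (hF : Measurable[countPast X lam t] F) {B : ℝ} (hB : ∀ w, ‖F w‖ ≤ B)
    (v : ℝ) :
    ∫ w, (F w : ℂ) * Complex.exp (v * X t w * Complex.I) ∂Q =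
      ∫ w, (F w : ℂ) * Complex.exp (lam t w * (Complex.exp (v * Complex.I) - 1)) ∂Q := by
  have hm := countPast_le h.measurable_X (h.measurable_lam 0) t
  have hFm : Measurable F := hF.mono hm le_rfl
  have hA : ∀ k, MeasurableSet (X t ⁻¹' {k}) := fun k =>
    h.measurable_X t (measurableSet_singleton k)
  have key := fun k => integral_mul_indicator_eq_of_condExp Q hm hF hB (hA k) (h.condLaw t {k})
  -- The same termwise integration is applied to the point mass at `X t` and to the Poisson weights.
  -- The coefficients agree by `key`, so the two sums coincide.
  have h1 := hasSum_integral_exp_mul Q hFm hB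
    (q := fun k => (X t ⁻¹' {k}).indicator fun _ => (1 : ℝ))
    (fun k => measurable_const.indicator (hA k))
    (fun k w => Set.indicator_nonneg (fun _ _ => zero_le_one) w)
    (fun w => by
      have := hasSum_ite_eq (X t w) (1 : ℝ)
      convert this using 2 with k
      by_cases hk : k = X t w
      · subst hk; simp
      · simp [hk, Ne.symm hk]) v
    (G := fun w => Complex.exp (v * X t w * Complex.I))
    (fun w => by
      have := hasSum_ite_eq (X t w) (Complex.exp (v * X t w * Complex.I))
      convert this using 2 with k
      by_cases hk : k = X t w
      · subst hk; simp
      · simp [hk, Ne.symm hk])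
  have h2 := hasSum_integral_exp_mul Q hFm hB
    (q := fun k w => (poissonMeasure (lam t w)).real {k})
    (fun k => (measurable_poissonMeasure_real {k}).comp (h.measurable_lam t))
    (fun k w => measureReal_nonneg)
    (fun w => by simpa using hasSum_measureReal_singleton (poissonMeasure (lam t w))) v
    (fun w => hasSum_exp_mul_poissonMeasure (lam t w) v)
  simp_rw [key] at h1
  exact h1.unique h2

end PoissonAutoregression

/-- Conditioning on a `σ`-field independent of the noise freezes the known argument. -/
lemma condExp_preimage_of_indep {Ω S U T : Type*} {m : MeasurableSpace Ω}
    [mΩ : MeasurableSpace Ω] [MeasurableSpace S] [mU : MeasurableSpace U] [MeasurableSpace T]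
    (Q : Measure Ω) [IsProbabilityMeasure Q] (hm : m ≤ mΩ) {Λ : Ω → S} {u : Ω → U}
    (hΛ : Measurable[m] Λ) (hu : Measurable u) (hind : Indep m (mU.comap u) Q)
    {f : S → U → T} (hf : Measurable (Function.uncurry f)) (κ : Kernel S T) [IsMarkovKernel κ]
    (hκ : ∀ s, (Q.map u).map (f s) = κ s) {A : Set T} (hA : MeasurableSet A) :
    Q⟦(fun w => f (Λ w) (u w)) ⁻¹' A | m⟧ =ᵐ[Q] fun w => (κ (Λ w)).real A := by
  have hΛ' : Measurable Λ := hΛ.mono hm le_rfl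
  have hfm : Measurable fun w => f (Λ w) (u w) := hf.comp (hΛ'.prodMk hu)
  have hκm : Measurable fun s => (κ s).real A := (κ.measurable_coe hA).ennreal_toReal
  have hκi : Integrable (fun w => (κ (Λ w)).real A) Q :=
    Integrable.of_bound (hκm.comp hΛ').aestronglyMeasurable 1
      (Eventually.of_forall fun w => by
        rw [Real.norm_of_nonneg measureReal_nonneg]
        exact measureReal_le_one)
  symm
  refine ae_eq_condExp_of_forall_setIntegral_eq hm
    ((integrable_const _).indicator (hfm hA)) (fun s _ _ => hκi.integrableOn) ?_
    (hκm.comp hΛ).stronglyMeasurable.aestronglyMeasurable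
  intro s hs _
  have hs' : MeasurableSet s := hm s hs
  -- The event `s` belongs to `m` and is absorbed into the first coordinate, so independence still
  -- yields a product law after restriction to `s`.
  have hlaw : (Q.restrict s).map (fun w => (Λ w, u w)) =
      ((Q.restrict s).map Λ).prod (Q.map u) := by
    refine (Measure.prod_eq fun B C hB hC => ?_).symm
    rw [Measure.map_apply (hΛ'.prodMk hu) (hB.prod hC), Measure.map_apply hΛ' hB,
      Measure.map_apply hu hC, Measure.restrict_apply' hs', Measure.restrict_apply' hs']
    have h1 := (Indep_iff _ _ Q).1 hind (Λ ⁻¹' B ∩ s) (u ⁻¹' C)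
      (MeasurableSet.inter (hΛ hB) hs) ⟨C, hC, rfl⟩
    rw [← h1]
    congr 1
    ext w
    simp only [Set.mem_inter_iff, Set.mem_preimage, Set.mem_prod]
    tauto
  have hAf : MeasurableSet (Function.uncurry f ⁻¹' A) := hf hA
  have h2 : (Q.restrict s) ((fun w => f (Λ w) (u w)) ⁻¹' A) = ∫⁻ w in s, κ (Λ w) A ∂Q := by
    have h3 := Measure.map_apply (μ := Q.restrict s) (hΛ'.prodMk hu) hAf
    rw [hlaw, Measure.prod_apply hAf] at h3
    rw [show (fun w => f (Λ w) (u w)) ⁻¹' A =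
      (fun w => (Λ w, u w)) ⁻¹' (Function.uncurry f ⁻¹' A) from rfl, ← h3,
      ← lintegral_map (κ.measurable_coe hA) hΛ']
    refine lintegral_congr fun x => ?_
    rw [← hκ x, Measure.map_apply (show Measurable (f x) from hf.comp measurable_prodMk_left) hA]
    rfl
  rw [integral_indicator_const _ (hfm hA), smul_eq_mul, mul_one, measureReal_def, h2,
    ← integral_toReal (f := fun w => κ (Λ w) A) ((κ.measurable_coe hA).comp hΛ').aemeasurable
      (Eventually.of_forall fun w => measure_lt_top _ _)]
  rfl

-- The coordinates are independent uniform variables. Coordinate `0` generates the initial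
-- intensity, and coordinate `t + 1` generates `X t` through a measurable map sending the uniform
-- law to the Poisson law with the current mean.
open unitInterval in
theorem exists_poissonAutoregression {c g b : ℝ} (hc : 0 ≤ c) (hg : 0 ≤ g) (hb : 0 ≤ b)
    (μ : Measure ℝ≥0) [IsProbabilityMeasure μ] :
    ∃ (Q : Measure (ℕ → I)) (_ : IsProbabilityMeasure Q) (X : ℕ → (ℕ → I) → ℕ)
      (lam : ℕ → (ℕ → I) → ℝ≥0),
      Q.map (lam 0) = μ ∧ PoissonAutoregression Q c g b X lam := by
  obtain ⟨f0, hf0, hf0μ⟩ := Measure.exists_measurable_map_eq μ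
  let κ : Kernel ℝ≥0 ℕ := ⟨poissonMeasure, by
    refine Measure.measurable_of_measurable_coe _ fun A _ => ?_
    have := (measurable_poissonMeasure_real A).ennreal_ofReal
    simpa using this⟩
  have hκ : ∀ r, κ r = poissonMeasure r := fun r => rfl
  have : IsMarkovKernel κ := ⟨fun r => by rw [hκ]; infer_instance⟩
  obtain ⟨f, hf, hfκ⟩ := Kernel.exists_measurable_map_eq_unitInterval κ
  let lam : ℕ → (ℕ → I) → ℝ≥0 := fun t w => Nat.rec (f0 (w 0))
    (fun t l => c.toNNReal + g.toNNReal * f l (w (t + 1)) + b.toNNReal * l) t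
  let X : ℕ → (ℕ → I) → ℕ := fun t w => f (lam t w) (w (t + 1))
  have hlam : ∀ t w, lam (t + 1) w =
    c.toNNReal + g.toNNReal * X t w + b.toNNReal * lam t w := fun t w => rfl
  have hXm : ∀ {m : MeasurableSpace (ℕ → I)} t, Measurable[m] (lam t) →
      Measurable[m] (fun w : ℕ → I => w (t + 1)) → Measurable[m] (X t) :=
    fun t h1 h2 => hf.comp (h1.prodMk h2)
  have hlm : ∀ {m : MeasurableSpace (ℕ → I)} t, Measurable[m] (lam t) →
      Measurable[m] (X t) → Measurable[m] (lam (t + 1)) := fun {m} t h1 h2 => by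
    have h3 : Measurable[m] fun w => (X t w : ℝ≥0) := (measurable_of_countable _).comp h2
    exact ((h3.const_mul _).const_add _).add (h1.const_mul _)
  have hmlam : ∀ t, Measurable (lam t) := fun t => by
    induction t with
    | zero => exact hf0.comp (measurable_pi_apply 0)
    | succ t ih => exact hlm t ih (hXm t ih (measurable_pi_apply _))
  have hmX : ∀ t, Measurable (X t) := fun t => hXm t (hmlam t) (measurable_pi_apply _)
  let Q : Measure (ℕ → I) := Measure.infinitePi fun _ => volume
  have hcoord : ∀ t, Q.map (fun w => w t) = volume := fun t => by
    exact Measure.infinitePi_map_eval _ t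
  have hind : iIndepFun (fun t (w : ℕ → I) => w t) Q :=
    iIndepFun_infinitePi (X := fun _ => id) fun _ => measurable_id
  refine ⟨Q, inferInstance, X, lam, ?_, hmX, hmlam, fun t A => ?_, fun t w => ?_⟩
  · have : lam 0 = f0 ∘ fun w : ℕ → I => w 0 := rfl
    rw [this, ← Measure.map_map hf0 (measurable_pi_apply 0), hcoord, hf0μ]
  -- The past of the counts lies in the `σ`-field of the coordinates up to `t`, which is independent
  -- of the coordinate `t + 1` driving `X t`.
  · let m : ℕ → MeasurableSpace (ℕ → I) := fun t =>
      ⨆ i ∈ Set.Iic t, MeasurableSpace.comap (fun w : ℕ → I => w i) inferInstance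
    have hmc : ∀ {i t}, i ≤ t → Measurable[m t] (fun w : ℕ → I => w i) := fun {i t} hit =>
      measurable_iff_comap_le.2 (le_iSup₂ (f := fun i (_ : i ∈ Set.Iic t) =>
        MeasurableSpace.comap (fun w : ℕ → I => w i) inferInstance) i hit)
    have hmono : ∀ {s t}, s ≤ t → m s ≤ m t := fun hst =>
      iSup₂_le fun i hi => (hmc (le_trans hi hst)).comap_le
    have hmlam' : ∀ t, Measurable[m t] (lam t) := fun t => by
      induction t with
      | zero => exact hf0.comp (hmc le_rfl)
      | succ t ih =>
        have := ih.mono (hmono t.le_succ) le_rfl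
        exact hlm t this (hXm t this (hmc le_rfl))
    have hmX' : ∀ t, Measurable[m (t + 1)] (X t) := fun t =>
      hXm t ((hmlam' t).mono (hmono t.le_succ) le_rfl) (hmc le_rfl)
    have hle : countPast X lam t ≤ m t := sup_le
      ((hmlam' 0).mono (hmono t.zero_le) le_rfl).comap_le
      (iSup₂_le fun s hs => ((hmX' s).mono (hmono (Finset.mem_range.1 hs)) le_rfl).comap_le)
    -- The intensity must be known from the counts and `lam 0` themselves, not just from the larger
    -- coordinate field; the recursion shows this.
    have hcl : ∀ s, s ≤ t → Measurable[countPast X lam t] (lam s) := fun s hs => by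
      induction s with
      | zero => exact measurable_countPast_initial t
      | succ s ih => exact hlm s (ih (by omega)) (measurable_countPast_count (by omega))
    have hindep : Indep (m t) (MeasurableSpace.comap (fun w : ℕ → I => w (t + 1)) inferInstance)
        Q := by
      have h1 := indep_iSup_of_disjoint (μ := Q)
        (m := fun i => MeasurableSpace.comap (fun w : ℕ → I => w i) inferInstance)
        (fun i => (measurable_pi_apply i).comap_le) hind (S := Set.Iic t) (T := {t + 1})
        (by simp)
      simpa only [iSup_singleton, Set.mem_singleton_iff, iSup_iSup_eq_left] using h1
    exact condExp_preimage_of_indep Q (countPast_le hmX (hmlam 0) t) (hcl t le_rfl)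
      (measurable_pi_apply (t + 1)) (indep_of_indep_of_le_left hindep hle) hf κ
      (fun s => by rw [hcoord, hfκ]) (MeasurableSet.of_discrete (s := A))
  · rw [hlam]
    push_cast
    rw [Real.coe_toNNReal _ hc, Real.coe_toNNReal _ hg, Real.coe_toNNReal _ hb]

end PoissonAutoregression

/-! ### Intensities as continuous functions of the past -/

section Paths

/-- The intensity `λ_t` as a function of the initial intensity and of the path of counts. -/
def intensityMap (c g b : ℝ) : ℕ → ℝ × (ℕ → ℕ) → ℝ
  -- The truncation at zero keeps the intensity nonnegative on the whole path space, so that the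
  -- Poisson characteristic function stays bounded there.
  | 0, z => max z.1 0
  | t + 1, z => c + g * (z.2 t : ℝ) + b * intensityMap c g b t z

lemma continuous_intensityMap (c g b : ℝ) (t : ℕ) : Continuous (intensityMap c g b t) := by
  induction t with
  | zero => exact continuous_fst.max continuous_const
  | succ t ih =>
    have : Continuous fun z : ℝ × (ℕ → ℕ) => (z.2 t : ℝ) :=
      continuous_of_discreteTopology.comp ((continuous_apply t).comp continuous_snd)
    exact (continuous_const.add (continuous_const.mul this)).add (continuous_const.mul ih)

lemma intensityMap_nonneg {c g b : ℝ} (hc : 0 ≤ c) (hg : 0 ≤ g) (hb : 0 ≤ b) (t : ℕ)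
    (z : ℝ × (ℕ → ℕ)) : 0 ≤ intensityMap c g b t z := by
  induction t with
  | zero => exact le_max_right _ _
  | succ t ih =>
    exact add_nonneg (add_nonneg hc (mul_nonneg hg (z.2 t).cast_nonneg))
      (mul_nonneg hb ih)

lemma intensityMap_congr {c g b : ℝ} {z z' : ℝ × (ℕ → ℕ)} (h0 : z.1 = z'.1) :
    ∀ t, (∀ s < t, z.2 s = z'.2 s) → intensityMap c g b t z = intensityMap c g b t z'
  | 0, _ => by simp [intensityMap, h0]
  | t + 1, h => by
    simp only [intensityMap]
    rw [h t (Nat.lt_succ_self t),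
      intensityMap_congr h0 t fun s hs => h s (hs.trans (Nat.lt_succ_self t))]

variable {Ω : Type*}

/-- An initial value together with the counts observed before date `t`, later counts being
replaced by `0`. -/
def truncatedPath (S : Ω → ℝ) (X : ℕ → Ω → ℕ) (t : ℕ) (w : Ω) : ℝ × (ℕ → ℕ) :=
  (S w, fun s => if s < t then X s w else 0)

lemma measurable_truncatedPath {m : MeasurableSpace Ω} {S : Ω → ℝ} {X : ℕ → Ω → ℕ} {t : ℕ}
    (hS : Measurable S) (hX : ∀ s < t, Measurable (X s)) : Measurable (truncatedPath S X t) := by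
  refine hS.prodMk (measurable_pi_lambda _ fun s => ?_)
  by_cases hs : s < t
  · simpa only [hs, if_true] using hX s hs
  · simpa only [hs, if_false] using measurable_const

lemma truncatedPath_snd_of_lt {S : Ω → ℝ} {X : ℕ → Ω → ℕ} {s t : ℕ} (h : s < t) (w : Ω) :
    (truncatedPath S X t w).2 s = X s w :=
  if_pos h

/-- All truncated paths share one state space, and adjoining a count is a continuous operation on
it; this is what lets the induction on `t` use the continuous mapping theorem. -/
lemma truncatedPath_succ (S : Ω → ℝ) (X : ℕ → Ω → ℕ) (t : ℕ) (w : Ω) :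
    truncatedPath S X (t + 1) w =
      ((truncatedPath S X t w).1, Function.update (truncatedPath S X t w).2 t (X t w)) := by
  refine Prod.ext rfl (funext fun s => ?_)
  rcases lt_trichotomy s t with h | h | h
  · simp [truncatedPath, Function.update_of_ne h.ne, h, h.not_gt]
  · simp [truncatedPath, h]
  · simp [truncatedPath, Function.update_of_ne h.ne', h.not_gt, h.not_ge]

lemma intensityMap_truncatedPath {c g b : ℝ} {S : Ω → ℝ} {X : ℕ → Ω → ℕ} {s t : ℕ} (hst : s ≤ t)
    (w : Ω) : intensityMap c g b s (truncatedPath S X t w) =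
      intensityMap c g b s (truncatedPath S X s w) :=
  intensityMap_congr (z := truncatedPath S X t w) (z' := truncatedPath S X s w) rfl s
    fun r hr => by simp [truncatedPath, hr, hr.trans_le hst]

lemma PoissonAutoregression.intensityMap_eq [MeasurableSpace Ω] {Q : Measure Ω} {c g b : ℝ}
    {X : ℕ → Ω → ℕ} {lam : ℕ → Ω → ℝ≥0} (h : PoissonAutoregression Q c g b X lam) {s t : ℕ}
    (hst : s ≤ t) (w : Ω) :
    intensityMap c g b s (truncatedPath (fun w => (lam 0 w : ℝ)) X t w) = lam s w := by
  induction s with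
  | zero => simp [intensityMap, truncatedPath]
  | succ s ih =>
    simp only [intensityMap]
    rw [ih (by omega), h.recursion]
    simp [truncatedPath, Nat.lt_of_succ_le hst]

end Paths

/-! ### Adjoining the next count -/

section Step

variable {Ω : ℕ → Type*} [∀ N, MeasurableSpace (Ω N)] {P : (N : ℕ) → Measure (Ω N)}
  [∀ N, IsProbabilityMeasure (P N)] {y : (N : ℕ) → Fin N → ℕ → Ω N → Bool}
  {p : (N : ℕ) → Fin N → ℕ → Ω N → ℝ} {ω α γ' β' : (N : ℕ) → Fin N → ℝ}
  {Ω' : Type*} [MeasurableSpace Ω'] {Q : Measure Ω'} [IsProbabilityMeasure Q]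
  {X : ℕ → Ω' → ℕ} {lam : ℕ → Ω' → ℝ≥0} {c g b : ℝ}

/-- If the past converges in distribution, the success probabilities are uniformly small and their
sum is asymptotically the limiting intensity, then the past and the next count converge jointly. -/
theorem tendstoInDistribution_truncatedPath_aggregateCount
    (hy : ∀ N i t, Measurable (y N i t)) (hp : ∀ N i t, Measurable (p N i t))
    (hmodel : ∀ᶠ N : ℕ in atTop, InteractiveGAB (P N) (ω N) (α N) (γ' N) (β' N) (y N) (p N))
    (hc : 0 ≤ c) (hg : 0 ≤ g) (hb : 0 ≤ b) (hX : PoissonAutoregression Q c g b X lam) (t : ℕ)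
    (hpast : TendstoInDistribution
      (fun N => truncatedPath (fun w => ∑ i, p N i 0 w) (aggregateCount (y N)) t) atTop
      (truncatedPath (fun w => (lam 0 w : ℝ)) X t) P Q)
    {D : (N : ℕ) → Ω N → ℝ} (hD : TendstoZeroInProb P D)
    (hpD : ∀ᶠ N in atTop, ∀ i w, p N i t w ≤ D N w)
    (hsum : TendstoZeroInProb P (fun N w => ∑ i, p N i t w - intensityMap c g b t
      (truncatedPath (fun w => ∑ i, p N i 0 w) (aggregateCount (y N)) t w))) :
    TendstoInDistribution
      (fun N w => (truncatedPath (fun w => ∑ i, p N i 0 w) (aggregateCount (y N)) t w,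
        aggregateCount (y N) t w)) atTop
      (fun w => (truncatedPath (fun w => (lam 0 w : ℝ)) X t w, X t w)) P Q := by
  set Z := fun N => truncatedPath (fun w => ∑ i, p N i 0 w) (aggregateCount (y N)) t
  set Z' := truncatedPath (fun w => (lam 0 w : ℝ)) X t with hZ'
  have hXm := fun N => measurable_aggregateCount (hy N) t
  have hZm : ∀ N, Measurable (Z N) := fun N =>
    measurable_truncatedPath (Finset.measurable_sum _ fun i _ => hp N i 0)
      fun s _ => measurable_aggregateCount (hy N) s
  have hZm' : Measurable Z' := measurable_truncatedPath (hX.measurable_lam 0).coe_nnreal_real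
    fun s _ => hX.measurable_X s
  refine tendstoInDistribution_prodMk_nat hZm hZm' hXm (hX.measurable_X t) fun f v => ?_
  change Tendsto (fun N => ∫ w, (f (Z N w) : ℂ) *
    Complex.exp (v * aggregateCount (y N) t w * Complex.I) ∂(P N)) atTop _
  set z : ℂ := Complex.exp (v * Complex.I) - 1
  have hzre : z.re ≤ 0 := re_exp_ofReal_mul_I_sub_one_nonpos v
  have hz2 : ‖z‖ ≤ 2 := norm_exp_mul_I_sub_one_le_two v
  have hfm : Measurable f := f.continuous.measurable
  have hLc := continuous_intensityMap c g b t
  have hL0 := intensityMap_nonneg hc hg hb t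
  have hpm := fun N i => hp N i t
  have hLm : ∀ N, Measurable fun w => intensityMap c g b t (Z N w) :=
    fun N => hLc.measurable.comp (hZm N)
  have hfZ : ∀ N, Measurable fun w => f (Z N w) := fun N => hfm.comp (hZm N)
  let φ : BoundedContinuousFunction (ℝ × (ℕ → ℕ)) ℂ :=
    BoundedContinuousFunction.ofNormedAddCommGroup
      (fun x => (f x : ℂ) * Complex.exp (intensityMap c g b t x * z)) (by fun_prop) ‖f‖
      (fun x => by
        rw [norm_mul, Complex.norm_real]
        exact (mul_le_of_le_one_right (norm_nonneg _)
          (norm_exp_ofReal_mul_le_one (hL0 x) hzre)).trans (f.norm_coe_le_norm x))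
  have hφ : ∀ x, φ x = (f x : ℂ) * Complex.exp (intensityMap c g b t x * z) := fun x => rfl
  have hlim := hpast.tendsto_integral_complex φ
  simp only [hφ] at hlim
  have hpast_lim : ∫ w, (f (Z' w) : ℂ) * Complex.exp (v * X t w * Complex.I) ∂Q =
      ∫ w, (f (Z' w) : ℂ) * Complex.exp (intensityMap c g b t (Z' w) * z) ∂Q := by
    have hm : Measurable[countPast X lam t] Z' :=
      measurable_truncatedPath (measurable_countPast_initial t).coe_nnreal_real
        fun s hs => measurable_countPast_count hs
    rw [hX.integral_mul_exp t (F := fun w => f (Z' w)) (hfm.comp hm)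
      (fun w => f.norm_coe_le_norm _) v]
    refine integral_congr_ae (Eventually.of_forall fun w => ?_)
    simp only [hZ', hX.intensityMap_eq le_rfl w]
    rfl
  rw [hpast_lim]
  -- The sum differs by a vanishing term from a continuous function of the convergent past.
  have hS : BoundedInProb P (fun N w => ∑ i, p N i t w) := by
    have h1 := (TendstoInDistribution.continuous_comp hLc hpast).boundedInProb
    refine (hsum.boundedInProb.add h1).mono (Eventually.of_forall fun N w => ?_)
    simp [Z]
  have hbound : ∀ N, InteractiveGAB (P N) (ω N) (α N) (γ' N) (β' N) (y N) (p N) → ∀ w,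
      ‖(f (Z N w) : ℂ) * ∏ i, (1 + p N i t w * z) -
        (f (Z N w) : ℂ) * Complex.exp (intensityMap c g b t (Z N w) * z)‖ ≤ ‖f‖ * 2 := by
    intro N hN w
    rw [← mul_sub, norm_mul, Complex.norm_real]
    refine mul_le_mul (f.norm_coe_le_norm _) ?_ (norm_nonneg _) (norm_nonneg _)
    refine (norm_sub_le _ _).trans ?_
    have h1 : ‖∏ i, (1 + p N i t w * z)‖ ≤ 1 := by
      rw [norm_prod]
      exact Finset.prod_le_one (fun i _ => norm_nonneg _) fun i _ =>
        norm_one_add_mul_exp_sub_one_le (hN.prob_mem i t w) v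
    linarith [norm_exp_ofReal_mul_le_one (hL0 (Z N w)) hzre]
  have hdiff : Tendsto (fun N => ∫ w, ((f (Z N w) : ℂ) * ∏ i, (1 + p N i t w * z) -
      (f (Z N w) : ℂ) * Complex.exp (intensityMap c g b t (Z N w) * z)) ∂(P N)) atTop (𝓝 0) := by
    refine tendsto_integral_zero_of_tendstoZeroInProb (B := ‖f‖ * 2)
      (Eventually.of_forall fun N => ?_) ?_ ?_
    · have h1 := hfZ N
      have h2 := hLm N
      have h3 := hpm N
      exact Measurable.aestronglyMeasurable (by fun_prop)
    · filter_upwards [hmodel] with N hN w using hbound N hN w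
    -- Two errors add up: Bernoulli against Poisson costs `8 D ∑ p`, and replacing the sum by the
    -- intensity costs at most `‖z‖ ≤ 2` times their difference.
    · refine (((hD.mul_bounded hS).mul_bounded (boundedInProb_const (‖f‖ * 8))).abs.add
        (hsum.mul_bounded (boundedInProb_const (‖f‖ * 2))).abs).mono ?_
      filter_upwards [hmodel, hpD] with N hN hpDN w
      have hS0 : 0 ≤ ∑ i, p N i t w := Finset.sum_nonneg fun i _ => (hN.prob_mem i t w).1
      have h1 := norm_prod_bernoulli_sub_exp_le (fun i => hN.prob_mem i t w) (fun i => hpDN i w) v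
      have h2 := norm_exp_ofReal_mul_sub_exp_le hS0 (hL0 (Z N w)) hzre
      rw [abs_norm, ← mul_sub, norm_mul, Complex.norm_real, abs_of_nonneg (by positivity)]
      have h3 : ‖∏ i, (1 + p N i t w * z) - Complex.exp (intensityMap c g b t (Z N w) * z)‖ ≤
          8 * |D N w * ∑ i, p N i t w| + 2 * |∑ i, p N i t w - intensityMap c g b t (Z N w)| := by
        refine (norm_sub_le_norm_sub_add_norm_sub _
          (Complex.exp ((∑ i, p N i t w : ℝ) * z)) _).trans (add_le_add ?_ ?_)
        · exact h1.trans (by gcongr; exact le_abs_self _)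
        · exact h2.trans (by gcongr)
      refine (mul_le_mul (f.norm_coe_le_norm (Z N w)) h3 (norm_nonneg _) (norm_nonneg _)).trans ?_
      rw [abs_mul (D N w * _), abs_mul (_ - _) (‖f‖ * 2), abs_of_nonneg (by positivity : 0 ≤ ‖f‖ * 8),
        abs_of_nonneg (by positivity : 0 ≤ ‖f‖ * 2)]
      exact le_of_eq (by ring)
  have htot := hdiff.add hlim
  rw [zero_add] at htot
  refine htot.congr' ?_
  filter_upwards [hmodel] with N hN
  have hm : Measurable[panelPast (y N) (p N) t] (Z N) :=
    measurable_truncatedPath (Finset.measurable_sum _ fun i _ => measurable_panelPast_initial t i)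
      fun s hs => Finset.measurable_sum _ fun i _ =>
        (measurable_of_countable Bool.toNat).comp (measurable_panelPast_outcome hs i)
  rw [hN.integral_mul_exp_aggregateCount t (F := fun w => f (Z N w)) (hfm.comp hm)
    (fun w => f.norm_coe_le_norm _) v, ← integral_add]
  · simp only [sub_add_cancel]
    rfl
  · have h1 := hfZ N
    have h2 := hLm N
    have h3 := hpm N
    refine Integrable.of_bound (C := ‖f‖ * 2) (Measurable.aestronglyMeasurable (by fun_prop))
      (Eventually.of_forall (hbound N hN))
  · exact Integrable.of_bound (C := ‖f‖) (φ.continuous.measurable.comp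
      (hZm N)).aestronglyMeasurable (Eventually.of_forall fun w => by
        rw [norm_mul, Complex.norm_real]
        exact (mul_le_of_le_one_right (norm_nonneg _)
          (norm_exp_ofReal_mul_le_one (hL0 _) hzre)).trans (f.norm_coe_le_norm _))

end Step

/-! ### The recursion for the largest probability and for the sum -/

section Recursion

variable {Ω : Type*} {N : ℕ} {y : Fin N → ℕ → Ω → Bool} {p : Fin N → ℕ → Ω → ℝ}

lemma cast_aggregateCount (t : ℕ) (w : Ω) :
    (aggregateCount y t w : ℝ) = ∑ j, ((y j t w).toNat : ℝ) := by
  simp [aggregateCount]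

variable [MeasurableSpace Ω] {P : Measure Ω} {c a γ : ℕ → ℝ} {β κ C : ℝ}

lemma InteractiveGAB.prob_succ_le
    (h : InteractiveGAB P (fun i : Fin N => c i / (N : ℝ)) (fun i : Fin N => a i / (N : ℝ) ^ κ)
      (fun i : Fin N => γ i) (fun _ : Fin N => β) y p)
    (hc : ∀ i, c i ≤ C) (ha : ∀ i, a i ≤ C) {t : ℕ} {w : Ω} {D : ℝ} (hD : ∀ i, p i t w ≤ D)
    (i : Fin N) :
    p i (t + 1) w ≤ C / (N : ℝ) + C / (N : ℝ) ^ κ + 1 / (N : ℝ) * aggregateCount y t w + D := by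
  have hN : (0 : ℝ) < N := by exact_mod_cast i.pos
  have hNκ : (0 : ℝ) < (N : ℝ) ^ κ := Real.rpow_pos_of_pos hN κ
  have h1 := h.omega_nonneg i
  have h2 := h.alpha_nonneg i
  have h3 := h.gamma_nonneg i
  have h4 := h.beta_nonneg i
  have h5 := h.sum_le_one i
  rw [h.recursion i t w, ← cast_aggregateCount]
  have e1 : c i / (N : ℝ) ≤ C / N := by gcongr; exact hc i
  have e2 : a i / (N : ℝ) ^ κ * ((y i t w).toNat : ℝ) ≤ C / (N : ℝ) ^ κ :=
    (mul_le_of_le_one_right h2 (by exact_mod_cast Bool.toNat_le (y i t w))).trans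
      (by gcongr; exact ha i)
  have e3 : γ i * (1 / (N : ℝ) * aggregateCount y t w) ≤ 1 / (N : ℝ) * aggregateCount y t w :=
    mul_le_of_le_one_left (by positivity) (by linarith)
  have e4 : β * p i t w ≤ D :=
    (mul_le_of_le_one_left (h.prob_mem i t w).1 (by linarith)).trans (hD i)
  linarith

/-- The `γ` terms share the factor `X_t / N` and the `β` terms the factor `β`, so both sum exactly.
The `α` terms are an error, since only `X_t` of them are nonzero, and `β ≤ 1` keeps the previous
error from growing. -/
lemma InteractiveGAB.abs_sum_prob_succ_sub_le
    (h : InteractiveGAB P (fun i : Fin N => c i / (N : ℝ)) (fun i : Fin N => a i / (N : ℝ) ^ κ)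
      (fun i : Fin N => γ i) (fun _ : Fin N => β) y p)
    (hN0 : 0 < N) (ha : ∀ i, a i ≤ C) (cbar γbar : ℝ) (t : ℕ) (w : Ω) (L : ℝ) :
    |∑ i, p i (t + 1) w - (cbar + γbar * aggregateCount y t w + β * L)| ≤
      |1 / (N : ℝ) * ∑ i ∈ Finset.range N, c i - cbar| +
        (C / (N : ℝ) ^ κ + |1 / (N : ℝ) * ∑ i ∈ Finset.range N, γ i - γbar|) *
          aggregateCount y t w + |∑ i, p i t w - L| := by
  have hN : (0 : ℝ) < N := by exact_mod_cast hN0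
  have hNκ : (0 : ℝ) < (N : ℝ) ^ κ := Real.rpow_pos_of_pos hN κ
  have hβ0 := h.beta_nonneg ⟨0, hN0⟩
  have hβ1 : β ≤ 1 := by
    have h1 := h.omega_nonneg ⟨0, hN0⟩
    have h2 := h.alpha_nonneg ⟨0, hN0⟩
    have h3 := h.gamma_nonneg ⟨0, hN0⟩
    have h5 := h.sum_le_one ⟨0, hN0⟩
    linarith
  set K : ℝ := (aggregateCount y t w : ℝ) with hK
  have hK0 : 0 ≤ K := Nat.cast_nonneg _
  have hA0 : 0 ≤ ∑ i : Fin N, a i / (N : ℝ) ^ κ * ((y i t w).toNat : ℝ) :=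
    Finset.sum_nonneg fun i _ => mul_nonneg (h.alpha_nonneg i) (Nat.cast_nonneg _)
  have hA1 : ∑ i : Fin N, a i / (N : ℝ) ^ κ * ((y i t w).toNat : ℝ) ≤ C / (N : ℝ) ^ κ * K := by
    rw [hK, cast_aggregateCount, Finset.mul_sum]
    refine Finset.sum_le_sum fun i _ => ?_
    gcongr
    exact ha i
  have hrec : ∑ i, p i (t + 1) w = 1 / (N : ℝ) * ∑ i ∈ Finset.range N, c i +
      ∑ i : Fin N, a i / (N : ℝ) ^ κ * ((y i t w).toNat : ℝ) +
      (1 / (N : ℝ) * ∑ i ∈ Finset.range N, γ i) * K + β * ∑ i, p i t w := by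
    simp_rw [h.recursion _ t w, ← cast_aggregateCount, Finset.sum_add_distrib]
    rw [← Finset.sum_range (fun i => c i / (N : ℝ)), ← Finset.sum_mul, ← Finset.mul_sum,
      ← Finset.sum_range (fun i => γ i), ← Finset.sum_div]
    ring
  have hsplit : ∑ i, p i (t + 1) w - (cbar + γbar * K + β * L) =
      (1 / (N : ℝ) * ∑ i ∈ Finset.range N, c i - cbar) +
      (∑ i : Fin N, a i / (N : ℝ) ^ κ * ((y i t w).toNat : ℝ) +
        (1 / (N : ℝ) * ∑ i ∈ Finset.range N, γ i - γbar) * K) +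
      β * (∑ i, p i t w - L) := by
    rw [hrec]; ring
  rw [hsplit]
  refine (abs_add_three _ _ _).trans (add_le_add (add_le_add le_rfl ?_) ?_)
  · refine (abs_add_le _ _).trans ?_
    rw [abs_of_nonneg hA0, abs_mul, abs_of_nonneg hK0, add_mul]
    exact add_le_add hA1 le_rfl
  · rw [abs_mul, abs_of_nonneg hβ0]
    exact mul_le_of_le_one_left (abs_nonneg _) hβ1

end Recursion

/-! ### Induction on the date -/

section Induction

variable {Ω : ℕ → Type*} [∀ N, MeasurableSpace (Ω N)] {P : (N : ℕ) → Measure (Ω N)}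
  [∀ N, IsProbabilityMeasure (P N)] {y : (N : ℕ) → Fin N → ℕ → Ω N → Bool}
  {p : (N : ℕ) → Fin N → ℕ → Ω N → ℝ} {c a γ : ℕ → ℝ} {β κ C cbar γbar : ℝ}
  {Ω' : Type*} [MeasurableSpace Ω'] {Q : Measure Ω'} [IsProbabilityMeasure Q]
  {X : ℕ → Ω' → ℕ} {lam : ℕ → Ω' → ℝ≥0}

/-- The past converges in distribution and the sum of the success probabilities is asymptotically
the limiting intensity at every date. -/
theorem tendstoInDistribution_truncatedPath
    (hκ : 0 < κ) (hc : ∀ i, c i ≤ C) (ha : ∀ i, a i ≤ C)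
    (hy : ∀ N i t, Measurable (y N i t)) (hp : ∀ N i t, Measurable (p N i t))
    (hmodel : ∀ᶠ N : ℕ in atTop, InteractiveGAB (P N)
      (fun i : Fin N => c i / (N : ℝ)) (fun i : Fin N => a i / (N : ℝ) ^ κ)
      (fun i : Fin N => γ i) (fun _ : Fin N => β) (y N) (p N))
    (hcbar : Tendsto (fun N : ℕ => 1 / (N : ℝ) * ∑ i ∈ Finset.range N, c i) atTop (𝓝 cbar))
    (hγbar : Tendsto (fun N : ℕ => 1 / (N : ℝ) * ∑ i ∈ Finset.range N, γ i) atTop (𝓝 γbar))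
    (hc0 : 0 ≤ cbar) (hγ0 : 0 ≤ γbar) (hβ0 : 0 ≤ β)
    (hX : PoissonAutoregression Q cbar γbar β X lam)
    (hsum : TendstoInDistribution (fun N w => ∑ i, p N i 0 w) atTop
      (fun w => (lam 0 w : ℝ)) P Q)
    (hmax : ∀ ε : ℝ, 0 < ε → Tendsto (fun N => P N {w | ε ≤ ⨆ i, p N i 0 w}) atTop (𝓝 0))
    (t : ℕ) :
    TendstoInDistribution
      (fun N => truncatedPath (fun w => ∑ i, p N i 0 w) (aggregateCount (y N)) t) atTop
      (truncatedPath (fun w => (lam 0 w : ℝ)) X t) P Q ∧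
    (∃ D : (N : ℕ) → Ω N → ℝ, TendstoZeroInProb P D ∧
      ∀ᶠ N in atTop, ∀ i w, p N i t w ≤ D N w) ∧
    TendstoZeroInProb P (fun N w => ∑ i, p N i t w - intensityMap cbar γbar β t
      (truncatedPath (fun w => ∑ i, p N i 0 w) (aggregateCount (y N)) t w)) := by
  induction t with
  | zero =>
    refine ⟨?_, ⟨fun N w => ⨆ i, p N i 0 w, ?_, ?_⟩, ?_⟩
    · have h := TendstoInDistribution.continuous_comp
        (g := fun s : ℝ => (s, fun _ : ℕ => (0 : ℕ))) (by fun_prop) hsum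
      convert h using 1
      · funext N w
        simp [truncatedPath]
      · funext w
        simp [truncatedPath]
    · intro ε hε
      refine (hmax ε hε).congr' ?_
      filter_upwards [hmodel] with N hN
      congr 1
      ext w
      have : 0 ≤ ⨆ i, p N i 0 w := Real.iSup_nonneg fun i => (hN.initial_mem i w).1
      simp only [Set.mem_ofPred_eq, abs_of_nonneg this]
    · exact Eventually.of_forall fun N i w =>
        le_ciSup (f := fun i => p N i 0 w) (Set.finite_range _).bddAbove i
    -- The initial sum is nonnegative under the model, so the truncation in `intensityMap` is
    -- inactive and the difference is zero.
    · refine (tendstoZeroInProb_const (e := fun _ => 0) tendsto_const_nhds).mono ?_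
      filter_upwards [hmodel] with N hN w
      have : 0 ≤ ∑ i, p N i 0 w := Finset.sum_nonneg fun i _ => (hN.initial_mem i w).1
      simp [intensityMap, truncatedPath, this]
  | succ t ih =>
    obtain ⟨hpast, ⟨D, hD, hpD⟩, hS⟩ := ih
    have hjoint := tendstoInDistribution_truncatedPath_aggregateCount hy hp hmodel hc0 hγ0 hβ0 hX t
      hpast hD hpD hS
    -- Tightness of the new count makes `X_t / N` and the `α` and `γ` errors vanish in probability.
    have hXb : BoundedInProb P (fun N w => (aggregateCount (y N) t w : ℝ)) :=
      (TendstoInDistribution.continuous_comp (g := fun x : (ℝ × (ℕ → ℕ)) × ℕ => (x.2 : ℝ))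
        (continuous_of_discreteTopology.comp continuous_snd) hjoint).boundedInProb
    have hNinv : Tendsto (fun N : ℕ => 1 / (N : ℝ)) atTop (𝓝 0) :=
      tendsto_one_div_atTop_nhds_zero_nat
    have hCN : Tendsto (fun N : ℕ => C / (N : ℝ)) atTop (𝓝 0) :=
      tendsto_const_div_atTop_nhds_zero_nat C
    have hCκ : Tendsto (fun N : ℕ => C / (N : ℝ) ^ κ) atTop (𝓝 0) :=
      ((tendsto_rpow_atTop hκ).comp tendsto_natCast_atTop_atTop).const_div_atTop C
    refine ⟨?_, ⟨fun N w => C / (N : ℝ) + C / (N : ℝ) ^ κ +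
      1 / (N : ℝ) * aggregateCount (y N) t w + D N w, ?_, ?_⟩, ?_⟩
    · have h := TendstoInDistribution.continuous_comp
        (g := fun x : (ℝ × (ℕ → ℕ)) × ℕ => (x.1.1, Function.update x.1.2 t x.2))
        (by fun_prop) hjoint
      convert h using 1
      · funext N w
        exact truncatedPath_succ _ _ _ _
      · funext w
        exact truncatedPath_succ _ _ _ _
    · have h1 := tendstoZeroInProb_const (P := P) (by simpa using hCN.add hCκ)
      exact (h1.add ((tendstoZeroInProb_const hNinv).mul_bounded hXb)).add hD
    · filter_upwards [hmodel, hpD] with N hN hpDN i w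
      exact hN.prob_succ_le hc ha (fun i => hpDN i w) i
    · have e1 : Tendsto (fun N : ℕ => |1 / (N : ℝ) * ∑ i ∈ Finset.range N, c i - cbar|) atTop
          (𝓝 0) := by simpa using (hcbar.sub_const cbar).abs
      have e2 : Tendsto (fun N : ℕ => C / (N : ℝ) ^ κ +
          |1 / (N : ℝ) * ∑ i ∈ Finset.range N, γ i - γbar|) atTop (𝓝 0) := by
        simpa using hCκ.add (hγbar.sub_const γbar).abs
      refine (((tendstoZeroInProb_const e1).add
        ((tendstoZeroInProb_const e2).mul_bounded hXb)).add hS.abs).mono ?_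
      filter_upwards [hmodel, eventually_gt_atTop 0] with N hN hN0 w
      simp only [intensityMap]
      rw [intensityMap_truncatedPath (Nat.le_succ t)]
      have h1 : (truncatedPath (fun w => ∑ i, p N i 0 w) (aggregateCount (y N)) (t + 1) w).2 t =
        aggregateCount (y N) t w := truncatedPath_snd_of_lt (Nat.lt_succ_self t) w
      rw [h1]
      exact (hN.abs_sum_prob_succ_sub_le hN0 ha cbar γbar t w _).trans (le_abs_self _)

lemma TendstoZeroInProb.sum {ι : Type*} (s : Finset ι) {g : ι → (N : ℕ) → Ω N → ℝ}
    (hg : ∀ i ∈ s, TendstoZeroInProb P (g i)) :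
    TendstoZeroInProb P (fun N w => ∑ i ∈ s, g i N w) := by
  classical
  induction s using Finset.induction_on with
  | empty => simpa using tendstoZeroInProb_const (P := P) (e := fun _ => 0) tendsto_const_nhds
  | insert i s hi ih =>
    simp_rw [Finset.sum_insert hi]
    exact (hg i (Finset.mem_insert_self i s)).add
      (ih fun j hj => hg j (Finset.mem_insert_of_mem hj))

end Induction

/-! ### Transfer of the limit law -/

section LimitLaw

variable {Ω : ℕ → Type*} [∀ N, MeasurableSpace (Ω N)] {P : (N : ℕ) → Measure (Ω N)}
  [∀ N, IsProbabilityMeasure (P N)] {Ω₁ Ω₂ : Type*} [MeasurableSpace Ω₁] [MeasurableSpace Ω₂]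
  {Q₁ : Measure Ω₁} [IsProbabilityMeasure Q₁] {Q₂ : Measure Ω₂} [IsProbabilityMeasure Q₂]

/-- The given initial limit and the constructed process live on different spaces; only the law of
the limit matters. -/
lemma MeasureTheory.TendstoInDistribution.congr_limit {E : Type*} [TopologicalSpace E]
    [MeasurableSpace E] [OpensMeasurableSpace E] {W : (N : ℕ) → Ω N → E} {V₁ : Ω₁ → E}
    {V₂ : Ω₂ → E} (h : TendstoInDistribution W atTop V₁ P Q₁) (hV : IdentDistrib V₂ V₁ Q₂ Q₁) :
    TendstoInDistribution W atTop V₂ P Q₂ := by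
  rw [tendstoInDistribution_iff_forall_integral h.forall_aemeasurable hV.aemeasurable_fst]
  intro f
  have h1 := (tendstoInDistribution_iff_forall_integral h.forall_aemeasurable
    h.aemeasurable_limit).1 h f
  have h2 := (hV.comp (u := f) f.continuous.measurable).integral_eq
  simp only [Function.comp_def] at h2
  rwa [h2]

/-- Portmanteau for the closed half-line. It allows a real-valued initial limit to be replaced by an
`ℝ≥0`-valued intensity. -/
lemma MeasureTheory.TendstoInDistribution.ae_nonneg {W : (N : ℕ) → Ω N → ℝ} {V : Ω₁ → ℝ}
    (h : TendstoInDistribution W atTop V P Q₁) (hW : ∀ᶠ N in atTop, ∀ w, 0 ≤ W N w) :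
    0 ≤ᵐ[Q₁] V := by
  have h1 := ProbabilityMeasure.limsup_measure_closed_le_of_tendsto h.tendsto
    (isClosed_Ici (a := (0 : ℝ)))
  simp only [ProbabilityMeasure.coe_mk] at h1
  have h2 : limsup (fun N => (P N).map (W N) (Set.Ici 0)) atTop = 1 := by
    refine Tendsto.limsup_eq (tendsto_const_nhds.congr' ?_)
    filter_upwards [hW] with N hN
    rw [Measure.map_apply_of_aemeasurable (h.forall_aemeasurable N) measurableSet_Ici,
      show W N ⁻¹' Set.Ici 0 = Set.univ from Set.eq_univ_of_forall hN, measure_univ]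
  rw [h2, Measure.map_apply_of_aemeasurable h.aemeasurable_limit measurableSet_Ici] at h1
  exact (prob_compl_eq_zero_iff₀ (h.aemeasurable_limit.nullMeasurable measurableSet_Ici)).2
    (le_antisymm prob_le_one h1)

end LimitLaw

/-! ### The limit theorem -/

theorem mainTheorem1
    {Ω : ℕ → Type*} [∀ N, MeasurableSpace (Ω N)]
    (P : (N : ℕ) → Measure (Ω N)) [∀ N, IsProbabilityMeasure (P N)]
    (y : (N : ℕ) → Fin N → ℕ → Ω N → Bool) (p : (N : ℕ) → Fin N → ℕ → Ω N → ℝ)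
    (c a γ : ℕ → ℝ) (β κ C cbar γbar : ℝ)
    (hκ : 0 < κ)
    (hc : ∀ i, 0 ≤ c i ∧ c i ≤ C) (ha : ∀ i, 0 ≤ a i ∧ a i ≤ C)
    (hy_meas : ∀ N i t, Measurable (y N i t)) (hp_meas : ∀ N i t, Measurable (p N i t))
    (hmodel : ∀ᶠ N : ℕ in atTop, InteractiveGAB (P N)
      (fun i : Fin N => c i / (N : ℝ)) (fun i : Fin N => a i / (N : ℝ) ^ κ)
      (fun i : Fin N => γ i) (fun _ : Fin N => β) (y N) (p N))
    (hcbar : Tendsto (fun N : ℕ => 1 / (N : ℝ) * ∑ i ∈ Finset.range N, c i) atTop (𝓝 cbar))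
    (hγbar : Tendsto (fun N : ℕ => 1 / (N : ℝ) * ∑ i ∈ Finset.range N, γ i) atTop (𝓝 γbar))
    {Ω₀ : Type*} [MeasurableSpace Ω₀] (P₀ : Measure Ω₀) [IsProbabilityMeasure P₀]
    (lam₀ : Ω₀ → ℝ) (hlam₀ : Integrable lam₀ P₀)
    (hsum : TendstoInDistribution (fun N w => ∑ i, p N i 0 w) atTop lam₀ P P₀)
    (hmean : Tendsto (fun N => ∑ i, ∫ w, p N i 0 w ∂(P N)) atTop (𝓝 (∫ w, lam₀ w ∂P₀)))
    (hmax : ∀ ε : ℝ, 0 < ε →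
      Tendsto (fun N => P N {w | ε ≤ ⨆ i, p N i 0 w}) atTop (𝓝 0)) :
    ∃ (Ω' : Type) (_ : MeasurableSpace Ω') (Q : Measure Ω') (_ : IsProbabilityMeasure Q)
      (X : ℕ → Ω' → ℕ) (lam : ℕ → Ω' → ℝ≥0),
      IdentDistrib (fun w => (lam 0 w : ℝ)) lam₀ Q P₀ ∧
      PoissonAutoregression Q cbar γbar β X lam ∧
      TendstoFDD P Q (fun N => aggregateCount (y N)) X ∧
      TendstoFDD P Q (fun N t w => (aggregateCount (y N) t w, ∑ i, p N i t w))
        (fun t w => (X t w, (lam t w : ℝ))) := by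

  have hmodel1 : ∀ᶠ N : ℕ in atTop, 0 < N ∧ InteractiveGAB (P N)
      (fun i : Fin N => c i / (N : ℝ)) (fun i : Fin N => a i / (N : ℝ) ^ κ)
      (fun i : Fin N => γ i) (fun _ : Fin N => β) (y N) (p N) :=
    (eventually_gt_atTop 0).and hmodel
  have hβ0 : 0 ≤ β := by
    obtain ⟨N, hN0, hN⟩ := hmodel1.exists
    exact hN.beta_nonneg ⟨0, hN0⟩
  have hc0 : 0 ≤ cbar := ge_of_tendsto' hcbar fun N =>
    mul_nonneg (by positivity) (Finset.sum_nonneg fun i _ => (hc i).1)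
  have hγ0 : 0 ≤ γbar := by
    refine ge_of_tendsto hγbar ?_
    filter_upwards [hmodel] with N hN
    rw [Finset.sum_range]
    exact mul_nonneg (by positivity) (Finset.sum_nonneg fun i _ => hN.gamma_nonneg i)
  have hlam0 : 0 ≤ᵐ[P₀] lam₀ := hsum.ae_nonneg (hmodel.mono fun N hN w =>
    Finset.sum_nonneg fun i _ => (hN.initial_mem i w).1)
  have hlamm : AEMeasurable (fun w => (lam₀ w).toNNReal) P₀ :=
    hsum.aemeasurable_limit.real_toNNReal
  have := Measure.isProbabilityMeasure_map hlamm
  obtain ⟨Q, hQ, X, lam, hlaw, hX⟩ := exists_poissonAutoregression hc0 hγ0 hβ0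
    (P₀.map fun w => (lam₀ w).toNNReal)
  have hident : IdentDistrib (fun w => (lam 0 w : ℝ)) lam₀ Q P₀ := by
    refine ⟨(hX.measurable_lam 0).coe_nnreal_real.aemeasurable, hsum.aemeasurable_limit, ?_⟩
    have h1 : Q.map (fun w => (lam 0 w : ℝ)) = (Q.map (lam 0)).map ((↑) : ℝ≥0 → ℝ) :=
      (Measure.map_map measurable_coe_nnreal_real (hX.measurable_lam 0)).symm
    rw [h1, hlaw, AEMeasurable.map_map_of_aemeasurable measurable_coe_nnreal_real.aemeasurable hlamm]
    refine Measure.map_congr ?_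
    filter_upwards [hlam0] with w hw
    exact Real.coe_toNNReal _ hw
  have hconv := tendstoInDistribution_truncatedPath hκ (fun i => (hc i).2) (fun i => (ha i).2)
    hy_meas hp_meas hmodel hcbar hγbar hc0 hγ0 hβ0 hX (hsum.congr_limit hident) hmax
  -- Truncation keeps the counts strictly before the horizon, so the horizon is one more than the
  -- last date in `I`.
  have hlt : ∀ (I : Finset ℕ) (t : I), (t : ℕ) < I.sup id + 1 := fun I t =>
    Nat.lt_succ_of_le (Finset.le_sup (f := id) t.2)
  refine ⟨ℕ → unitInterval, inferInstance, Q, hQ, X, lam, hident, hX, fun I => ?_, fun I => ?_⟩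
  · have h := TendstoInDistribution.continuous_comp
      (g := fun (z : ℝ × (ℕ → ℕ)) (t : I) => z.2 t) (by fun_prop) (hconv (I.sup id + 1)).1
    convert h using 1
    · funext N w t
      exact (truncatedPath_snd_of_lt (hlt I t) w).symm
    · funext w t
      exact (truncatedPath_snd_of_lt (hlt I t) w).symm
  · have hcont : Continuous fun (z : ℝ × (ℕ → ℕ)) (t : I) =>
        (z.2 t, intensityMap cbar γbar β t z) :=
      continuous_pi fun t => ((continuous_apply _).comp continuous_snd).prodMk
        (continuous_intensityMap cbar γbar β t)
    have h := TendstoInDistribution.continuous_comp hcont (hconv (I.sup id + 1)).1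
    have hlimit : (fun (z : ℝ × (ℕ → ℕ)) (t : I) => (z.2 t, intensityMap cbar γbar β t z)) ∘
        truncatedPath (fun w => (lam 0 w : ℝ)) X (I.sup id + 1) =
        fun w (t : I) => (X t w, (lam t w : ℝ)) := by
      funext w t
      exact Prod.ext (truncatedPath_snd_of_lt (S := fun w => (lam 0 w : ℝ)) (hlt I t) w)
        (hX.intensityMap_eq (hlt I t).le w)
    rw [hlimit] at h
    -- Slutsky: the sup distance over `I` is at most the finite sum of the intensity errors, the
    -- counts being identical.
    refine h.of_tendstoZeroInProb_dist (fun N => Measurable.aemeasurable ?_) ?_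
    · exact measurable_pi_lambda _ fun t => (measurable_aggregateCount (hy_meas N) t).prodMk
        (Finset.measurable_sum _ fun i _ => hp_meas N i t)
    · refine (TendstoZeroInProb.sum Finset.univ
        fun (t : I) _ => (hconv t).2.2.abs).mono (Eventually.of_forall fun N w => ?_)
      rw [abs_of_nonneg dist_nonneg]
      refine le_trans ?_ (le_abs_self _)
      refine (dist_pi_le_iff (Finset.sum_nonneg fun _ _ => abs_nonneg _)).2 fun t => ?_
      refine le_trans ?_ (Finset.single_le_sum (f := fun t : I => |∑ i, p N i t w -
        intensityMap cbar γbar β t (truncatedPath (fun w => ∑ i, p N i 0 w)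
          (aggregateCount (y N)) t w)|) (fun _ _ => abs_nonneg _) (Finset.mem_univ t))
      simp only [Function.comp_apply, Prod.dist_eq]
      rw [intensityMap_truncatedPath (hlt I t).le, truncatedPath_snd_of_lt (hlt I t), dist_self]
      exact max_le (abs_nonneg _) le_rfl
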